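/- Let $M$ be a connected smooth Riemannian manifold without boundary (not necessarily compact), let $p:\tilde M\to M$ be its universal covering, and let $f:M\to M$ be a $C^1$-diffeomorphism. Suppose $f$ is (absolutely) partially hyperbolic: there are continuous $Tf$-invariant subbundles with $TM=E^s\oplus E^c\oplus E^u$, $0\neq E^c\neq TM$ (where $E^s$ or $E^u$ may be zero), such that - for some $n>0$, $\|Tf^n v\|<\tfrac12$ for all unit vectors $v\in E^s$; - for some $n>0$, $\|Tf^n v\|>2$ for all unit vectors $v\in E^u$; - for each of the pairs $(E,E')=(E^s,E^c),(E^c,E^u),(E^s,E^u)$ there is $n>0$ with $\|Tf^n v\|<\tfrac12\|Tf^n w\|$ for all $x,y\in M$ and all unit vectors $v\in E_x$, $w\in E'_y$. A foliation here is a continuous foliation with $C^1$ leaves, and it is tangent to a subbundle $E$ if the tangent spaces of its leaves are the fibers of $E$. Suppose that $W^s,W^c,W^u,W^{cs},W^{cu}$ are foliations of $M$ tangent to $E^s$, $E^c$, $E^u$, $E^c\oplus E^s$, $E^c\oplus E^u$ respectively, and that the center foliation $W^c$ is a subfoliation of both $W^{cs}$ and $W^{cu}$ (every center leaf lies in a leaf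 of $W^{cs}$ and in a leaf of $W^{cu}$). Suppose that $f$ has Global Product Structure, that is, for the foliations lifted to $\tilde M$ (denoted by the same letters, $W(x)$ being the leaf through $x$) and for all $x,y\in\tilde M$: 1. $W^u(x)$ and $W^{cs}(y)$ intersect exactly once; 2. $W^s(x)$ and $W^{cu}(y)$ intersect exactly once; 3. if $x\in W^{cs}(y)$, then $W^c(x)$ and $W^s(y)$ intersect exactly once; 4. if $x\in W^{cu}(y)$, then $W^c(x)$ and $W^u(y)$ intersect exactly once. Suppose also that $W^c$ is without holonomy: for every closed curve $\alpha$ contained in a leaf of $W^c$ and every small transversal $\tau$ through $\alpha(0)$, of dimension complementary to that of $W^c$, the holonomy germ on $\tau$ at $\alpha(0)$, defined by following leaves of $W^c$ along paths close to $\alpha$, is the germ of the identity. Then any two leaves of $W^c$ on $M$, with their leaf topologies, are homeomorphic. -/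

import Mathlib

open Set Filter Bundle
open scoped Manifold ContDiff Topology

universe u v

/-! ### Subbundles of the tangent bundle and partially hyperbolic splittings -/

section Splittings

variable {d : ℕ} {M : Type u} [TopologicalSpace M] [ChartedSpace (EuclideanSpace ℝ (Fin d)) M]

/-- A field of tangent subspaces is a continuous subbundle of `TM` if it is spanned, near every
point, by a continuous frame. -/
def IsContinuousSubbundle [IsManifold (𝓡 d) ∞ M]
    (E : (x : M) → Submodule ℝ (TangentSpace (𝓡 d) x)) : Prop :=
  ∀ x : M, ∃ k : ℕ, ∃ U ∈ 𝓝 x, ∃ v : Fin k → (y : M) → TangentSpace (𝓡 d) y,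
    (∀ i, ContinuousOn (fun y => (⟨y, v i y⟩ : TangentBundle (𝓡 d) M)) U) ∧
    ∀ y ∈ U, LinearIndependent ℝ (fun i => v i y) ∧
      Submodule.span ℝ (Set.range fun i => v i y) = E y

/-- `E` is invariant under the derivative of `f`. -/
def IsTangentInvariant (f : M → M) (E : (x : M) → Submodule ℝ (TangentSpace (𝓡 d) x)) : Prop :=
  ∀ x : M, (E x).map (mfderiv (𝓡 d) (𝓡 d) f x).toLinearMap = E (f x)

variable [RiemannianBundle (fun x : M => TangentSpace (𝓡 d) x)]

/-- `E` is contracting: some iterate of `f` maps all unit vectors of `E` to vectors of length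
less than `1 / 2`. -/
def IsContracting (f : M → M) (E : (x : M) → Submodule ℝ (TangentSpace (𝓡 d) x)) : Prop :=
  ∃ n : ℕ, 0 < n ∧ ∀ (x : M), ∀ v ∈ E x, ‖v‖ = 1 →
    ‖mfderiv (𝓡 d) (𝓡 d) (f^[n]) x v‖ < 1 / 2

/-- `E` is expanding: some iterate of `f` maps all unit vectors of `E` to vectors of length
greater than `2`. -/
def IsExpanding (f : M → M) (E : (x : M) → Submodule ℝ (TangentSpace (𝓡 d) x)) : Prop :=
  ∃ n : ℕ, 0 < n ∧ ∀ (x : M), ∀ v ∈ E x, ‖v‖ = 1 →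
    2 < ‖mfderiv (𝓡 d) (𝓡 d) (f^[n]) x v‖

/-- `E₂` absolutely dominates `E₁`; the two unit vectors may be based at different points. -/
def AbsolutelyDominates (f : M → M)
    (E₂ E₁ : (x : M) → Submodule ℝ (TangentSpace (𝓡 d) x)) : Prop :=
  ∃ n : ℕ, 0 < n ∧ ∀ (x y : M), ∀ v ∈ E₁ x, ∀ w ∈ E₂ y, ‖v‖ = 1 → ‖w‖ = 1 →
    ‖mfderiv (𝓡 d) (𝓡 d) (f^[n]) x v‖ < 1 / 2 * ‖mfderiv (𝓡 d) (𝓡 d) (f^[n]) y w‖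

/-- `TM = Es ⊕ Ec ⊕ Eu` is a partially hyperbolic splitting for `f` (in the absolute sense).
`Es` or `Eu` may be the zero bundle. -/
structure IsPartiallyHyperbolic [IsManifold (𝓡 d) ∞ M] (f : M → M)
    (Es Ec Eu : (x : M) → Submodule ℝ (TangentSpace (𝓡 d) x)) : Prop where
  continuous_s : IsContinuousSubbundle Es
  continuous_c : IsContinuousSubbundle Ec
  continuous_u : IsContinuousSubbundle Eu
  invariant_s : IsTangentInvariant f Es
  invariant_c : IsTangentInvariant f Ec
  invariant_u : IsTangentInvariant f Eu
  disjoint_s_c : ∀ x, Disjoint (Es x) (Ec x)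
  isCompl_sc_u : ∀ x, IsCompl (Es x ⊔ Ec x) (Eu x)
  c_dominates_s : AbsolutelyDominates f Ec Es
  u_dominates_c : AbsolutelyDominates f Eu Ec
  u_dominates_s : AbsolutelyDominates f Eu Es
  contracting_s : IsContracting f Es
  expanding_u : IsExpanding f Eu
  center_ne_zero : ∃ x, Ec x ≠ ⊥
  center_ne_tangent : ∃ x, Ec x ≠ ⊤

end Splittings

/-! ### Foliations -/

/-- A (continuous) foliation with `C¹` leaves on the manifold `M`, given by an atlas of foliated
charts. A chart `φ` takes values in `ℝ^dim × ℝ^codim`; its plaques are the sets on which the second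
coordinate is constant. Transition maps locally preserve plaques, and every plaque is
parametrized in a `C¹` way by the first coordinate. -/
structure Foliation (d : ℕ) (M : Type u) [TopologicalSpace M]
    [ChartedSpace (EuclideanSpace ℝ (Fin d)) M] where
  dim : ℕ
  codim : ℕ
  charts : Set (OpenPartialHomeomorph M
    (EuclideanSpace ℝ (Fin dim) × EuclideanSpace ℝ (Fin codim)))
  exists_chart : ∀ x : M, ∃ φ ∈ charts, x ∈ φ.source
  compatible : ∀ φ ∈ charts, ∀ ψ ∈ charts, ∀ x ∈ φ.source ∩ ψ.source, ∃ U ∈ 𝓝 x,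
    U ⊆ φ.source ∩ ψ.source ∧
    ∀ y ∈ U, ∀ z ∈ U, ((φ y).2 = (φ z).2 ↔ (ψ y).2 = (ψ z).2)
  contMDiffOn_plaque : ∀ φ ∈ charts, ∀ c : EuclideanSpace ℝ (Fin codim),
    ContMDiffOn (𝓡 dim) (𝓡 d) 1 (fun a => φ.symm (a, c)) {a | (a, c) ∈ φ.target}

namespace Foliation

variable {d : ℕ} {M : Type u} [TopologicalSpace M] [ChartedSpace (EuclideanSpace ℝ (Fin d)) M]

/-- The foliation is tangent to `E`: the plaques are immersed, with tangent spaces given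
by `E`. -/
def IsTangentTo (W : Foliation d M) (E : (x : M) → Submodule ℝ (TangentSpace (𝓡 d) x)) : Prop :=
  ∀ φ ∈ W.charts, ∀ z ∈ φ.target,
    Function.Injective (mfderiv (𝓡 W.dim) (𝓡 d) (fun a => φ.symm (a, z.2)) z.1) ∧
    LinearMap.range (mfderiv (𝓡 W.dim) (𝓡 d) (fun a => φ.symm (a, z.2)) z.1).toLinearMap =
      E (φ.symm (z.1, z.2))

/-- The leaf topology on the whole of `M`: it is generated by the relatively open subsets of
plaques. -/
@[reducible] def leafTopology (W : Foliation d M) : TopologicalSpace M :=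
  TopologicalSpace.generateFrom
    {s | ∃ φ ∈ W.charts, ∃ U : Set M, IsOpen U ∧ ∃ c,
      s = {y | y ∈ U ∧ y ∈ φ.source ∧ (φ y).2 = c}}

/-- A path that runs inside a leaf, continuously for the leaf topology. -/
def IsLeafPath (W : Foliation d M) (γ : unitInterval → M) : Prop :=
  @Continuous unitInterval M _ W.leafTopology γ

/-- The leaf through `x`: the path component of `x` for the leaf topology. -/
def leaf (W : Foliation d M) (x : M) : Set M :=
  {y | ∃ γ : unitInterval → M, W.IsLeafPath γ ∧ γ 0 = x ∧ γ 1 = y}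

/-- The leaf through `x` as a space of its own. -/
def Leaf (W : Foliation d M) (x : M) : Type u := {y : M // y ∈ W.leaf x}

/-- Leaves carry the leaf topology (in general finer than the subspace topology of `M`). -/
instance (W : Foliation d M) (x : M) : TopologicalSpace (W.Leaf x) :=
  W.leafTopology.induced Subtype.val

/-- `W` is a subfoliation of `W'`: leaves of `W` are contained in leaves of `W'`, the inclusions
being continuous for the leaf topologies. -/
def IsSubfoliation (W W' : Foliation d M) : Prop :=
  ∀ γ : unitInterval → M, W.IsLeafPath γ → W'.IsLeafPath γ

/-- The leaf through `x` of the foliation of `M'` that is lifted from `W` along a covering map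
`p : M' → M`. -/
def liftLeaf (W : Foliation d M) {M' : Type v} [TopologicalSpace M'] (p : M' → M) (x : M') :
    Set M' :=
  {y | ∃ γ : C(unitInterval, M'), W.IsLeafPath (p ∘ γ) ∧ γ 0 = x ∧ γ 1 = y}

/-- `τ` is a small transversal through `x`: it contains `x`, has the complementary dimension, and
is the image of a continuous section of the local projection that collapses the plaques of
a foliated chart. -/
def IsTransversal (W : Foliation d M) (τ : Set M) (x : M) : Prop :=
  x ∈ τ ∧ ∃ φ ∈ W.charts, ∃ (V : Set (EuclideanSpace ℝ (Fin W.codim)))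
    (σ : EuclideanSpace ℝ (Fin W.codim) → M), IsOpen V ∧ ContinuousOn σ V ∧
      (∀ c ∈ V, σ c ∈ φ.source ∧ (φ (σ c)).2 = c) ∧ τ = σ '' V

/-- `h` represents the holonomy germ at `x = α 0` along the leafwise closed curve `α`, on the
transversal `τ`: points `z ∈ τ` near `x` are moved to points `h z ∈ τ` by following leaves along
paths as close to `α` as we like (in the compact-open topology). -/
def IsHolonomy (W : Foliation d M) (α : C(unitInterval, M)) (τ : Set M) (h : M → M) : Prop :=
  ∀ U ∈ 𝓝 α, ∀ᶠ z in 𝓝[τ] (α 0), h z ∈ τ ∧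
    ∃ β ∈ U, W.IsLeafPath β ∧ β 0 = z ∧ β 1 = h z

/-- The holonomy along every closed curve on a leaf is (the germ of) the identity. -/
def WithoutHolonomy (W : Foliation d M) : Prop :=
  ∀ α : C(unitInterval, M), W.IsLeafPath α → α 1 = α 0 →
    ∀ τ : Set M, W.IsTransversal τ (α 0) →
      ∀ h : M → M, W.IsHolonomy α τ h → ∀ᶠ z in 𝓝[τ] (α 0), h z = z

end Foliation

/-- Global Product Structure, for the foliations lifted along the universal covering `p`. -/
structure HasGlobalProductStructure {d : ℕ} {M : Type u} [TopologicalSpace M]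
    [ChartedSpace (EuclideanSpace ℝ (Fin d)) M] {M' : Type v} [TopologicalSpace M'] (p : M' → M)
    (Ws Wc Wu Wcs Wcu : Foliation d M) : Prop where
  u_cs : ∀ x y : M', ∃! z, z ∈ Wu.liftLeaf p x ∧ z ∈ Wcs.liftLeaf p y
  s_cu : ∀ x y : M', ∃! z, z ∈ Ws.liftLeaf p x ∧ z ∈ Wcu.liftLeaf p y
  c_s : ∀ x y : M', x ∈ Wcs.liftLeaf p y → ∃! z, z ∈ Wc.liftLeaf p x ∧ z ∈ Ws.liftLeaf p y
  c_u : ∀ x y : M', x ∈ Wcu.liftLeaf p y → ∃! z, z ∈ Wc.liftLeaf p x ∧ z ∈ Wu.liftLeaf p y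

/-! On the universal covering, Global Product Structure lets center leaves slide onto each other.
For y in the center leaf of x and a stable leaf joining x to z, send y to the unique point of W^s(y)
∩ W^cu(z). This point lies in W^cs(z) ∩ W^cu(z), which is the single center leaf W^c(z) (`mem_c`).
Sliding back is the inverse. The same works along unstable leaves, and any two points are linked by
a stable slide, a move inside a center leaf and an unstable slide. The inclusions W^s ⊂ W^cs and W^u
⊂ W^cu are not part of the hypotheses. They follow from the uniqueness of intersections
(`s_subset_cs`, `u_subset_cu`).

The slide descends to M if it respects deck transformations, and this is where holonomy enters. If g
fixes one lifted center leaf, the set of z with g z ∈ W^c(z) is open, because a path from z to g z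
projects to a closed leaf curve and has trivial holonomy
(`WithoutHolonomy.eventually_map_mem_liftLeaf`). It is closed, because intersection points depend
continuously on the leaves. Hence g fixes every lifted center leaf, and then uniqueness of
intersections makes g commute with the slide (`nonempty_leaf_homeomorph_of_product`).

Two analytic facts support the argument. Leaves tangent to complementary continuous bundles
intersect locally (`IsTangentTo.eventually_exists_inter`), although the foliations are only
continuous transversally. This makes the intersection points continuous. Secondly, plaques of W^cs
and W^cu meet locally in plaques of W^c (`IsTangentTo.eventually_snd_eq_of_snd_eq`). It follows that
lifted center leaves are embedded, so that maps continuous on the covering space are continuous for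
the leaf topologies. -/

/-! ### Transverse intersections of families of `C¹` maps -/

section Transversality

/-- A zero of a map with invertible derivative persists in a continuous family of `C¹` maps; the
derivatives need not depend continuously on the parameter. -/
theorem eventually_exists_zero_of_bijective_fderiv {Z R V : Type*} [TopologicalSpace Z]
    [NormedAddCommGroup R] [NormedSpace ℝ R] [FiniteDimensional ℝ R]
    [NormedAddCommGroup V] [NormedSpace ℝ V] [FiniteDimensional ℝ V]
    {g : Z × R → V} {z₀ : Z × R} (hcont : ∀ᶠ z in 𝓝 z₀, ContinuousAt g z)
    (hdiff : ∀ᶠ z in 𝓝 z₀, ContDiffAt ℝ 1 (fun r => g (z.1, r)) z.2)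
    (hbij : ∀ᶠ z in 𝓝 z₀, Function.Bijective (fderiv ℝ (fun r => g (z.1, r)) z.2))
    (hz : g z₀ = 0) {N : Set R} (hN : N ∈ 𝓝 z₀.2) :
    ∀ᶠ z in 𝓝 z₀.1, ∃ r ∈ N, g (z, r) = 0 := by
  obtain ⟨x₀, r₀⟩ := z₀
  simp only at hN ⊢
  have hall := (hcont.and (hdiff.and hbij)).and
    (continuous_snd.continuousAt.preimage_mem_nhds hN : ∀ᶠ z in 𝓝 (x₀, r₀), z.2 ∈ N)
  rw [nhds_prod_eq] at hall
  obtain ⟨P, hP, Q, hQ, hPQ⟩ := eventually_prod_iff.1 hall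
  have hstrict : ∀ {x r}, ContDiffAt ℝ 1 (fun r => g (x, r)) r →
      HasStrictFDerivAt (fun r => g (x, r)) (fderiv ℝ (fun r => g (x, r)) r) r :=
    fun h => h.hasStrictFDerivAt one_ne_zero
  have hker : (fderiv ℝ (fun r => g (x₀, r)) r₀).ker = ⊥ :=
    LinearMap.ker_eq_bot.2 (hPQ hP.self_of_nhds hQ.self_of_nhds).1.2.2.1
  -- By the inverse function theorem r₀ is an isolated zero of the slice at x₀, so this slice is
  -- bounded away from 0 on a small sphere around r₀.
  obtain ⟨c, hc, hanti⟩ : ∃ S ∈ 𝓝 r₀, InjOn (fun r => g (x₀, r)) S := by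
    have h1 := hstrict (hPQ hP.self_of_nhds hQ.self_of_nhds).1.2.1
    let e := ContinuousLinearEquiv.ofBijective _ hker
      (LinearMap.range_eq_top.2 (hPQ hP.self_of_nhds hQ.self_of_nhds).1.2.2.2)
    have h2 : HasStrictFDerivAt (fun r => g (x₀, r)) (e : R →L[ℝ] V) r₀ := by
      have h3 : (e : R →L[ℝ] V) = fderiv ℝ (fun r => g (x₀, r)) r₀ := by ext; rfl
      rw [h3]; exact h1
    exact ⟨(h2.toOpenPartialHomeomorph _).source,
      (h2.toOpenPartialHomeomorph _).open_source.mem_nhds h2.mem_toOpenPartialHomeomorph_source,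
      (h2.toOpenPartialHomeomorph _).injOn⟩
  obtain ⟨δ, hδ, hball⟩ := Metric.nhds_basis_closedBall.mem_iff.1 (inter_mem hc hQ)
  have hQb : ∀ r ∈ Metric.closedBall r₀ δ, Q r := fun r hr => (hball hr).2
  have hsphere : ∃ ρ > 0, ∀ r ∈ Metric.sphere r₀ δ, ρ < ‖g (x₀, r)‖ := by
    have hcts : ContinuousOn (fun r => ‖g (x₀, r)‖) (Metric.sphere r₀ δ) := by
      intro r hr
      have := (hPQ hP.self_of_nhds (hQb r (Metric.sphere_subset_closedBall hr))).1.2.1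
      exact this.continuousAt.norm.continuousWithinAt
    have hne : ∀ r ∈ Metric.sphere r₀ δ, g (x₀, r) ≠ 0 := by
      intro r hr h0
      have := hanti (hball (Metric.sphere_subset_closedBall hr)).1
        (hball (Metric.mem_closedBall_self hδ.le)).1 (by simp only [h0, hz])
      rw [this, Metric.mem_sphere, dist_self] at hr
      exact hδ.ne hr
    rcases (Metric.sphere r₀ δ).eq_empty_or_nonempty with hemp | hnem
    · exact ⟨1, one_pos, by simp [hemp]⟩
    · obtain ⟨r, hr, hmin⟩ := (isCompact_sphere r₀ δ).exists_isMinOn hnem hcts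
      refine ⟨‖g (x₀, r)‖ / 2, half_pos (norm_pos_iff.2 (hne r hr)), fun r' hr' => ?_⟩
      exact (half_lt_self (norm_pos_iff.2 (hne r hr))).trans_le (hmin hr')
  obtain ⟨ρ, hρ, hsph⟩ := hsphere
  have e1 : ∀ᶠ x in 𝓝 x₀, ∀ r ∈ Metric.sphere r₀ δ, ρ < ‖g (x, r)‖ := by
    refine (isCompact_sphere r₀ δ).eventually_forall_of_forall_eventually fun r hr => ?_
    have := (hPQ hP.self_of_nhds (hQb r (Metric.sphere_subset_closedBall hr))).1.1
    exact this.norm.eventually (lt_mem_nhds (hsph r hr))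
  have e2 : ∀ᶠ x in 𝓝 x₀, ‖g (x, r₀)‖ < ρ := by
    have h1 : ContinuousAt (fun x => ‖g (x, r₀)‖) x₀ :=
      ((hPQ hP.self_of_nhds hQ.self_of_nhds).1.1.comp
        (f := fun x => (x, r₀)) (by fun_prop)).norm
    exact h1.eventually (gt_mem_nhds (by simpa [hz] using hρ))
  filter_upwards [e1, e2, hP] with x hx1 hx2 hPx
  have hd : ∀ r ∈ Metric.closedBall r₀ δ, _ := fun r hr => (hPQ hPx (hQb r hr)).1
  have hcl : ContinuousOn (fun r => g (x, r)) (Metric.closedBall r₀ δ) :=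
    fun r hr => (hd r hr).2.1.continuousAt.continuousWithinAt
  -- A surjective strict derivative makes the slice an open map on the ball.
  have hopen : IsOpen ((fun r => g (x, r)) '' Metric.ball r₀ δ) := by
    rw [isOpen_iff_mem_nhds]
    rintro _ ⟨r, hr, rfl⟩
    have h := hd r (Metric.ball_subset_closedBall hr)
    have := (hstrict h.2.1).map_nhds_eq_of_surj (LinearMap.range_eq_top.2 h.2.2.2)
    rw [← this]
    exact image_mem_map (Metric.isOpen_ball.mem_nhds hr)
  have hopen' : IsOpen ((fun r => g (x, r)) '' Metric.closedBall r₀ δ)ᶜ :=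
    ((isCompact_closedBall r₀ δ).image_of_continuousOn hcl).isClosed.isOpen_compl
  -- The image of the sphere avoids the ρ-ball. This ball is therefore covered by two disjoint open
  -- sets: the image of the open ball and the complement of the image of the closed ball. Being
  -- connected and meeting the first at g (x, r₀), it lies in the first, and so does 0.
  have hsub : Metric.ball (0 : V) ρ ⊆ (fun r => g (x, r)) '' Metric.ball r₀ δ := by
    refine IsPreconnected.subset_left_of_subset_union hopen hopen' ?_ ?_ ?_
      (convex_ball (0 : V) ρ).isPreconnected
    · exact disjoint_compl_right.mono_left (image_mono Metric.ball_subset_closedBall)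
    · intro v hv
      by_contra hcon
      simp only [mem_union, mem_compl_iff, not_or, not_not] at hcon
      obtain ⟨hn, r, hr, rfl⟩ := hcon
      have hr' : r ∈ Metric.sphere r₀ δ := by
        rw [← Metric.ball_union_sphere] at hr
        exact hr.resolve_left fun h => hn ⟨r, h, rfl⟩
      exact absurd (mem_ball_zero_iff.1 hv) (not_lt.2 (hx1 r hr').le)
    · exact ⟨g (x, r₀), mem_ball_zero_iff.2 hx2, r₀, Metric.mem_ball_self hδ, rfl⟩
  obtain ⟨r, hr, hr0⟩ := hsub (Metric.mem_ball_self hρ)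
  exact ⟨r, (hPQ hPx (hQb r (Metric.ball_subset_closedBall hr))).2, hr0⟩

/-- A continuous family of immersed `C¹` discs in `V`, parametrized by `P`, whose tangent spaces
are spanned by a frame that is continuous at `z₀`. -/
structure IsImmersedFamilyAt {P A V : Type*} [TopologicalSpace P]
    [NormedAddCommGroup A] [NormedSpace ℝ A] [NormedAddCommGroup V] [NormedSpace ℝ V]
    {ι : Type*} [Fintype ι] (α : P × A → V) (v : P × A → ι → V) (z₀ : P × A) : Prop where
  continuousAt : ∀ᶠ z in 𝓝 z₀, ContinuousAt α z
  contDiffAt : ∀ᶠ z in 𝓝 z₀, ContDiffAt ℝ 1 (fun a => α (z.1, a)) z.2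
  range_fderiv : ∀ᶠ z in 𝓝 z₀,
    (fderiv ℝ (fun a => α (z.1, a)) z.2).range = Submodule.span ℝ (range (v z))
  continuousAt_frame : ContinuousAt v z₀
  finrank_eq : Module.finrank ℝ A = Fintype.card ι

/-- Intersections of discs are zeros of the difference α - β, whose derivative in the disc variables
is bijective exactly when the tangent spaces are complementary. Complementarity persists because
linear independence of the joint frame is an open condition. Only the tangent spaces have to vary
continuously, not the derivatives of the parametrizations. -/
theorem IsImmersedFamilyAt.eventually_exists_eq {P Q A B V : Type*}
    [TopologicalSpace P] [TopologicalSpace Q]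
    [NormedAddCommGroup A] [NormedSpace ℝ A] [FiniteDimensional ℝ A]
    [NormedAddCommGroup B] [NormedSpace ℝ B] [FiniteDimensional ℝ B]
    [NormedAddCommGroup V] [NormedSpace ℝ V] [FiniteDimensional ℝ V]
    {ι κ : Type*} [Fintype ι] [Fintype κ] {α : P × A → V}
    {v : P × A → ι → V} {z₀ : P × A}
    {β : Q × B → V} {w : Q × B → κ → V} {w₀ : Q × B}
    (hα : IsImmersedFamilyAt α v z₀) (hβ : IsImmersedFamilyAt β w w₀)
    (h₀ : α z₀ = β w₀) (hli : LinearIndependent ℝ (Sum.elim (v z₀) (w w₀)))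
    (hdim : Fintype.card ι + Fintype.card κ = Module.finrank ℝ V) {N : Set (A × B)} (hN : N ∈ 𝓝 (z₀.2, w₀.2)) :
    ∀ᶠ x in 𝓝 (z₀.1, w₀.1), ∃ r ∈ N, α (x.1, r.1) = β (x.2, r.2) := by
  let g : (P × Q) × (A × B) → V := fun z => α (z.1.1, z.2.1) - β (z.1.2, z.2.2)
  let y₀ : (P × Q) × (A × B) := ((z₀.1, w₀.1), (z₀.2, w₀.2))
  have t1 : Tendsto (fun z : (P × Q) × (A × B) => (z.1.1, z.2.1)) (𝓝 y₀) (𝓝 z₀) :=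
    (show Continuous fun z : (P × Q) × (A × B) => (z.1.1, z.2.1) by fun_prop).tendsto y₀
  have t2 : Tendsto (fun z : (P × Q) × (A × B) => (z.1.2, z.2.2)) (𝓝 y₀) (𝓝 w₀) :=
    (show Continuous fun z : (P × Q) × (A × B) => (z.1.2, z.2.2) by fun_prop).tendsto y₀
  have hopen : ∀ᶠ z in 𝓝 y₀,
      LinearIndependent ℝ (Sum.elim (v (z.1.1, z.2.1)) (w (z.1.2, z.2.2))) := by
    have hc : ContinuousAt (fun z : (P × Q) × (A × B) =>
        (Sum.elim (v (z.1.1, z.2.1)) (w (z.1.2, z.2.2)) : ι ⊕ κ → V)) y₀ := by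
      rw [continuousAt_pi]
      rintro (i | j)
      · exact (continuousAt_pi.1 hα.continuousAt_frame i).tendsto.comp t1
      · exact (continuousAt_pi.1 hβ.continuousAt_frame j).tendsto.comp t2
    exact hc.eventually (isOpen_setOfPred_linearIndependent.mem_nhds hli)
  have key : ∀ᶠ z in 𝓝 y₀.1, ∃ r ∈ N, g (z, r) = 0 := by
    refine eventually_exists_zero_of_bijective_fderiv (z₀ := y₀) (g := g) ?_ ?_ ?_ ?_ hN
    · filter_upwards [t1.eventually hα.continuousAt, t2.eventually hβ.continuousAt] with z h1 h2
      exact (h1.comp (f := fun z : (P × Q) × (A × B) => (z.1.1, z.2.1)) (by fun_prop)).sub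
        (h2.comp (f := fun z : (P × Q) × (A × B) => (z.1.2, z.2.2)) (by fun_prop))
    · filter_upwards [t1.eventually hα.contDiffAt, t2.eventually hβ.contDiffAt] with z h1 h2
      exact (h1.comp z.2 (f := fun r : A × B => r.1) contDiffAt_fst).sub
        (h2.comp z.2 (f := fun r : A × B => r.2) contDiffAt_snd)
    · filter_upwards [t1.eventually hα.contDiffAt, t2.eventually hβ.contDiffAt,
        t1.eventually hα.range_fderiv, t2.eventually hβ.range_fderiv, hopen] with z h1 h2 h3 h4 h5
      have d1 := (h1.differentiableAt one_ne_zero).hasFDerivAt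
      have d2 := (h2.differentiableAt one_ne_zero).hasFDerivAt
      have d : fderiv ℝ (fun r => g (z.1, r)) z.2 = _ :=
        ((d1.comp z.2 (f := fun r : A × B => r.1) hasFDerivAt_fst).sub
        (d2.comp z.2 (f := fun r : A × B => r.2) hasFDerivAt_snd)).fderiv
      rw [d]
      rw [linearIndependent_sum] at h5
      obtain ⟨h5a, h5b, h5c⟩ := h5
      simp only [Sum.elim_comp_inl, Sum.elim_comp_inr] at h5a h5b h5c
      rw [← h3, ← h4] at h5c
      have inj1 : Function.Injective (fderiv ℝ (fun a => α (z.1.1, a)) z.2.1) := by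
        have hr : Module.finrank ℝ (fderiv ℝ (fun a => α (z.1.1, a)) z.2.1).range = Fintype.card ι := by
          rw [h3, finrank_span_eq_card h5a]
        have := LinearMap.finrank_range_add_finrank_ker
          (fderiv ℝ (fun a => α (z.1.1, a)) z.2.1).toLinearMap
        have h0 : Module.finrank ℝ (fderiv ℝ (fun a => α (z.1.1, a)) z.2.1).ker = 0 := by
          have := hα.finrank_eq; omega
        exact LinearMap.ker_eq_bot.1 (Submodule.finrank_eq_zero.1 h0)
      have inj2 : Function.Injective (fderiv ℝ (fun b => β (z.1.2, b)) z.2.2) := by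
        have hr : Module.finrank ℝ (fderiv ℝ (fun b => β (z.1.2, b)) z.2.2).range = Fintype.card κ := by
          rw [h4, finrank_span_eq_card h5b]
        have := LinearMap.finrank_range_add_finrank_ker
          (fderiv ℝ (fun b => β (z.1.2, b)) z.2.2).toLinearMap
        have h0 : Module.finrank ℝ (fderiv ℝ (fun b => β (z.1.2, b)) z.2.2).ker = 0 := by
          have := hβ.finrank_eq; omega
        exact LinearMap.ker_eq_bot.1 (Submodule.finrank_eq_zero.1 h0)
      set L := fderiv ℝ (fun a => α (z.1.1, a)) z.2.1 with hL
      set K := fderiv ℝ (fun b => β (z.1.2, b)) z.2.2 with hK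
      have inj : Function.Injective
          ((L.comp (ContinuousLinearMap.fst ℝ A B) - K.comp (ContinuousLinearMap.snd ℝ A B) :
            A × B →L[ℝ] V) : A × B →ₗ[ℝ] V) := by
        rw [← LinearMap.ker_eq_bot, LinearMap.ker_eq_bot']
        rintro ⟨a, b⟩ hab
        have hab' : L a = K b := by simpa [sub_eq_zero] using hab
        have h0 : L a = 0 := by
          have := h5c.le_bot (show L a ∈ _ from ⟨⟨a, rfl⟩, ⟨b, hab'.symm⟩⟩)
          simpa using this
        have ha : a = 0 := inj1 (by rw [h0, map_zero])
        have hb : b = 0 := inj2 (by rw [← hab', h0, map_zero])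
        simp [ha, hb]
      have hfr : Module.finrank ℝ (A × B) = Module.finrank ℝ V := by
        rw [Module.finrank_prod, hα.finrank_eq, hβ.finrank_eq, hdim]
      exact ⟨inj, (LinearMap.injective_iff_surjective_of_finrank_eq_finrank hfr).1 inj⟩
    · simp [g, y₀, h₀]
  filter_upwards [key] with x ⟨r, hr, h⟩
  exact ⟨r, hr, sub_eq_zero.1 h⟩

end Transversality

/-! ### Leaf paths -/

/-- The concatenation of two functions on the unit interval. -/
noncomputable def pathConcat {X : Type*} (γ δ : unitInterval → X) (s : unitInterval) : X :=
  if (s : ℝ) ≤ 1 / 2 then γ (projIcc 0 1 zero_le_one (2 * s))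
    else δ (projIcc 0 1 zero_le_one (2 * s - 1))

section Concat

variable {X Y : Type*}

theorem continuous_pathConcat [TopologicalSpace X] {γ δ : unitInterval → X} (hγ : Continuous γ)
    (hδ : Continuous δ) (h : γ 1 = δ 0) : Continuous (pathConcat γ δ) := by
  refine Continuous.if_le (hγ.comp (continuous_projIcc.comp (by fun_prop)))
    (hδ.comp (continuous_projIcc.comp (by fun_prop))) (by fun_prop) (by fun_prop) ?_
  intro s hs
  rw [hs]
  convert h using 2
  · exact projIcc_of_right_le _ (by norm_num)
  · exact projIcc_of_le_left _ (by norm_num)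

theorem pathConcat_zero (γ δ : unitInterval → X) : pathConcat γ δ 0 = γ 0 := by
  rw [pathConcat, if_pos (by norm_num)]
  congr 1
  exact projIcc_of_le_left _ (by norm_num)

theorem pathConcat_one (γ δ : unitInterval → X) : pathConcat γ δ 1 = δ 1 := by
  rw [pathConcat, if_neg (by norm_num)]
  congr 1
  exact projIcc_of_right_le _ (by norm_num)

theorem comp_pathConcat (f : X → Y) (γ δ : unitInterval → X) :
    f ∘ pathConcat γ δ = pathConcat (f ∘ γ) (f ∘ δ) := by
  funext s
  simp only [pathConcat, Function.comp_apply, apply_ite f]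

theorem pathConcat_rel {r : X → Y → Prop} {γ δ : unitInterval → X} {γ' δ' : unitInterval → Y}
    (h : ∀ s, r (γ s) (γ' s)) (h' : ∀ s, r (δ s) (δ' s)) (s : unitInterval) :
    r (pathConcat γ δ s) (pathConcat γ' δ' s) := by
  unfold pathConcat
  split_ifs
  exacts [h _, h' _]

end Concat

namespace Foliation

variable {d : ℕ} {M : Type u} [TopologicalSpace M] [ChartedSpace (EuclideanSpace ℝ (Fin d)) M]
  (W : Foliation d M)

/-- Because charts locally preserve each other's plaques, every chart at x yields the same traces
near x, and one chart suffices to compute leaf neighborhoods. -/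
theorem nhds_leafTopology {φ} (hφ : φ ∈ W.charts) {x : M} (hx : x ∈ φ.source) :
    @nhds M W.leafTopology x = 𝓝[{y | (φ y).2 = (φ x).2}] x := by
  rw [TopologicalSpace.nhds_generateFrom]
  apply le_antisymm
  · intro s hs
    obtain ⟨U, hU, hxU, hs⟩ := mem_nhdsWithin.1 hs
    refine mem_iInf_of_mem {y | y ∈ U ∧ y ∈ φ.source ∧ (φ y).2 = (φ x).2} ?_
    refine mem_iInf_of_mem ⟨⟨hxU, hx, rfl⟩, φ, hφ, U, hU, _, rfl⟩ ?_
    exact fun y hy => hs ⟨hy.1, hy.2.2⟩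
  · refine le_iInf₂ fun s hs => ?_
    obtain ⟨hxs, ψ, hψ, U, hU, c, rfl⟩ := hs
    obtain ⟨hxU, hxψ, rfl⟩ := hxs
    obtain ⟨V, hV, -, hVV⟩ := W.compatible φ hφ ψ hψ x ⟨hx, hxψ⟩
    rw [le_principal_iff]
    filter_upwards [mem_nhdsWithin_of_mem_nhds hV, mem_nhdsWithin_of_mem_nhds (hU.mem_nhds hxU),
      mem_nhdsWithin_of_mem_nhds (ψ.open_source.mem_nhds hxψ), self_mem_nhdsWithin]
      with y h1 h2 h3 h4
    exact ⟨h2, h3, (hVV y h1 x (mem_of_mem_nhds hV)).1 h4⟩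

theorem leafTopology_le : W.leafTopology ≤ ‹TopologicalSpace M› := by
  rw [le_iff_nhds]
  intro x
  obtain ⟨φ, hφ, hx⟩ := W.exists_chart x
  rw [W.nhds_leafTopology hφ hx]
  exact nhdsWithin_le_nhds

variable {W}

theorem isLeafPath_iff {γ : unitInterval → M} : W.IsLeafPath γ ↔
    ∀ t, Tendsto γ (𝓝 t) (@nhds M W.leafTopology (γ t)) := by
  let := W.leafTopology
  exact continuous_iff_continuousAt

theorem IsLeafPath.continuous {γ : unitInterval → M} (hγ : W.IsLeafPath γ) : Continuous γ :=
  continuous_iff_continuousAt.2 fun t =>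
    (isLeafPath_iff.1 hγ t).mono_right (le_iff_nhds _ _ |>.1 W.leafTopology_le _)

theorem IsLeafPath.eventually {γ : unitInterval → M} (hγ : W.IsLeafPath γ) {φ} (hφ : φ ∈ W.charts)
    {t : unitInterval} (ht : γ t ∈ φ.source) : ∀ᶠ s in 𝓝 t, (φ (γ s)).2 = (φ (γ t)).2 := by
  have := isLeafPath_iff.1 hγ t
  rw [W.nhds_leafTopology hφ ht] at this
  exact this self_mem_nhdsWithin

theorem isLeafPath_of_eventually {γ : unitInterval → M} (hγ : Continuous γ)
    (h : ∀ t, ∃ φ ∈ W.charts, γ t ∈ φ.source ∧ ∀ᶠ s in 𝓝 t, (φ (γ s)).2 = (φ (γ t)).2) :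
    W.IsLeafPath γ := by
  refine isLeafPath_iff.2 fun t => ?_
  obtain ⟨φ, hφ, ht, hev⟩ := h t
  rw [W.nhds_leafTopology hφ ht]
  exact tendsto_nhdsWithin_iff.2 ⟨hγ.tendsto t, hev⟩

/-- Inside a foliated chart a leaf path stays in a single plaque. -/
theorem IsLeafPath.snd_eq {γ : unitInterval → M} (hγ : W.IsLeafPath γ) {φ} (hφ : φ ∈ W.charts)
    {K : Set unitInterval} (hK : IsPreconnected K) (hKφ : ∀ s ∈ K, γ s ∈ φ.source)
    {s t : unitInterval} (hs : s ∈ K) (ht : t ∈ K) : (φ (γ s)).2 = (φ (γ t)).2 := by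
  refine hK.induction₂ (fun s t => (φ (γ s)).2 = (φ (γ t)).2) ?_ ?_ ?_ hs ht
  · intro x hx
    filter_upwards [nhdsWithin_le_nhds (hγ.eventually hφ (hKφ x hx))] with y hy using hy.symm
  · exact fun _ _ _ _ _ _ h h' => h.trans h'
  · exact fun _ _ _ _ h => h.symm

theorem isLeafPath_const (x : M) : W.IsLeafPath fun _ => x := by
  let := W.leafTopology
  exact (continuous_const : Continuous fun _ : unitInterval => x)

theorem IsLeafPath.comp {γ : unitInterval → M} (hγ : W.IsLeafPath γ)
    {θ : unitInterval → unitInterval} (hθ : Continuous θ) : W.IsLeafPath (γ ∘ θ) := by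
  let := W.leafTopology
  exact Continuous.comp (g := γ) hγ hθ

theorem IsLeafPath.concat {γ δ : unitInterval → M} (hγ : W.IsLeafPath γ) (hδ : W.IsLeafPath δ)
    (h : γ 1 = δ 0) : W.IsLeafPath (pathConcat γ δ) := by
  let := W.leafTopology
  exact continuous_pathConcat hγ hδ h

theorem IsLeafPath.if_le {γ δ : unitInterval → M} (hγ : W.IsLeafPath γ) (hδ : W.IsLeafPath δ)
    {a : unitInterval} (h : γ a = δ a) : W.IsLeafPath fun s => if s ≤ a then γ s else δ s := by
  let := W.leafTopology
  exact Continuous.if_le hγ hδ continuous_id continuous_const fun s hs => by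
    have : s = a := hs
    rw [this, h]

/-! ### Lifted leaves -/

variable {M' : Type v} [TopologicalSpace M'] {p : M' → M}

variable (W p) in
/-- A foliated chart of the foliation lifted along `p`. -/
def IsLiftChart (ψ : OpenPartialHomeomorph M'
    (EuclideanSpace ℝ (Fin W.dim) × EuclideanSpace ℝ (Fin W.codim))) : Prop :=
  ∃ φ ∈ W.charts, ∀ y ∈ ψ.source, p y ∈ φ.source ∧ ψ y = φ (p y)

theorem exists_liftChart (hp : IsLocalHomeomorph p) {φ} (hφ : φ ∈ W.charts) {x : M'}
    (hx : p x ∈ φ.source) : ∃ ψ, x ∈ ψ.source ∧ ψ.source ⊆ p ⁻¹' φ.source ∧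
      (∀ y, ψ y = φ (p y)) ∧ W.IsLiftChart p ψ := by
  obtain ⟨e, he, rfl⟩ := hp x
  refine ⟨e.trans φ, ⟨he, hx⟩, fun y hy => hy.2, fun y => rfl, φ, hφ, fun y hy => ⟨hy.2, rfl⟩⟩

/-- A path in a chart along which the transverse coordinate is constant is a leaf path. -/
theorem IsLiftChart.isLeafPath {ψ} (hψ : W.IsLiftChart p ψ) (hp : Continuous p)
    {γ : unitInterval → M'} (hγ : Continuous γ) (hs : ∀ t, γ t ∈ ψ.source)
    (h : ∀ t, (ψ (γ t)).2 = (ψ (γ 0)).2) : W.IsLeafPath (p ∘ γ) := by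
  obtain ⟨φ, hφ, hψφ⟩ := hψ
  refine isLeafPath_of_eventually (hp.comp hγ) fun t => ⟨φ, hφ, (hψφ _ (hs t)).1, ?_⟩
  refine Eventually.of_forall fun s => ?_
  simp only [Function.comp_apply]
  rw [← (hψφ _ (hs s)).2, ← (hψφ _ (hs t)).2, h, h t]

/-- Nearby points in the same plaque are joined by a short leaf path. -/
theorem eventually_exists_isLeafPath (hp : IsLocalHomeomorph p) {φ} (hφ : φ ∈ W.charts) {x : M'}
    (hx : p x ∈ φ.source) {N : Set M'} (hN : N ∈ 𝓝 x) :
    ∀ᶠ y : M' × M' in 𝓝 (x, x), (φ (p y.1)).2 = (φ (p y.2)).2 →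
      ∃ γ : unitInterval → M', Continuous γ ∧ W.IsLeafPath (p ∘ γ) ∧ γ 0 = y.1 ∧ γ 1 = y.2 ∧
        ∀ t, γ t ∈ N := by
  obtain ⟨ψ, hxψ, -, hψφ, hψ⟩ := exists_liftChart hp hφ hx
  have hT : ∀ᶠ z in 𝓝 (ψ x), z ∈ ψ.target ∧ ψ.symm z ∈ N := by
    refine Eventually.and (ψ.open_target.mem_nhds (ψ.map_source hxψ)) ?_
    refine (ψ.continuousAt_symm (ψ.map_source hxψ)).eventually (p := fun y => y ∈ N) ?_
    rwa [ψ.left_inv hxψ]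
  obtain ⟨r, hr, hball⟩ := Metric.eventually_nhds_iff_ball.1 hT
  have hB : ∀ᶠ y in 𝓝 x, y ∈ ψ.source ∧ ψ y ∈ Metric.ball (ψ x) r :=
    Eventually.and (ψ.open_source.mem_nhds hxψ)
      ((ψ.continuousAt hxψ).eventually (Metric.ball_mem_nhds _ hr))
  rw [nhds_prod_eq]
  filter_upwards [hB.prod_mk hB] with ⟨y, z⟩ ⟨⟨hy, hyr⟩, hz, hzr⟩ hyz
  simp only at hy hyr hz hzr hyz ⊢
  -- The path is a straight segment in the chart: it stays in a convex ball, and its transverse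
  -- coordinate is constant since the endpoints share it.
  let ℓ : unitInterval → EuclideanSpace ℝ (Fin W.dim) × EuclideanSpace ℝ (Fin W.codim) :=
    fun t => AffineMap.lineMap (ψ y) (ψ z) (t : ℝ)
  have hℓ : Continuous ℓ := AffineMap.lineMap_continuous.comp continuous_subtype_val
  have hℓr : ∀ t, ℓ t ∈ Metric.ball (ψ x) r := fun t =>
    (convex_ball (ψ x) r).lineMap_mem hyr hzr t.2
  have hℓ2 : ∀ t, (ℓ t).2 = (ψ y).2 := by
    intro t
    have h2 : (ψ z).2 = (ψ y).2 := by rw [hψφ, hψφ, hyz]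
    simp [ℓ, AffineMap.lineMap_apply, h2]
  have h0 : ψ.symm (ℓ 0) = y := by simp [ℓ, ψ.left_inv hy]
  refine ⟨fun t => ψ.symm (ℓ t), ?_, ?_, h0, by simp [ℓ, ψ.left_inv hz], fun t =>
    (hball _ (hℓr t)).2⟩
  · exact ψ.continuousOn_symm.comp_continuous hℓ fun t => (hball _ (hℓr t)).1
  · refine hψ.isLeafPath hp.continuous
      (ψ.continuousOn_symm.comp_continuous hℓ fun t => (hball _ (hℓr t)).1)
      (fun t => ψ.map_target (hball _ (hℓr t)).1) fun t => ?_
    rw [ψ.right_inv (hball _ (hℓr t)).1, ψ.right_inv (hball _ (hℓr 0)).1, hℓ2, hℓ2]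

theorem mem_liftLeaf_of_path {γ : unitInterval → M'} (hγ : Continuous γ)
    (h : W.IsLeafPath (p ∘ γ)) : γ 1 ∈ W.liftLeaf p (γ 0) :=
  ⟨⟨γ, hγ⟩, h, rfl, rfl⟩

theorem mem_liftLeaf_self (x : M') : x ∈ W.liftLeaf p x :=
  mem_liftLeaf_of_path (γ := fun _ => x) continuous_const (isLeafPath_const (p x))

theorem liftLeaf_symm {x y : M'} (h : y ∈ W.liftLeaf p x) : x ∈ W.liftLeaf p y := by
  obtain ⟨γ, hγ, rfl, rfl⟩ := h
  have := mem_liftLeaf_of_path (W := W) (p := p) (γ := γ ∘ unitInterval.symm)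
    (γ.continuous.comp unitInterval.continuous_symm) (hγ.comp unitInterval.continuous_symm)
  simpa using this

theorem liftLeaf_trans {x y z : M'} (h : y ∈ W.liftLeaf p x) (h' : z ∈ W.liftLeaf p y) :
    z ∈ W.liftLeaf p x := by
  obtain ⟨γ, hγ, rfl, rfl⟩ := h
  obtain ⟨δ, hδ, hδ0, rfl⟩ := h'
  have := mem_liftLeaf_of_path (W := W) (p := p) (γ := pathConcat γ δ)
    (continuous_pathConcat γ.continuous δ.continuous hδ0.symm)
    (by rw [comp_pathConcat]; exact hγ.concat hδ (by simp [hδ0]))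
  rwa [pathConcat_zero, pathConcat_one] at this

theorem liftLeaf_subset_of_isSubfoliation {W₁ W₂ : Foliation d M} (h : W₁.IsSubfoliation W₂)
    (x : M') : W₁.liftLeaf p x ⊆ W₂.liftLeaf p x := by
  rintro y ⟨γ, hγ, h0, h1⟩
  exact ⟨γ, h _ hγ, h0, h1⟩

theorem map_mem_liftLeaf {g : M' → M'} (hg : Continuous g) (hpg : p ∘ g = p) {x y : M'}
    (h : y ∈ W.liftLeaf p x) : g y ∈ W.liftLeaf p (g x) := by
  obtain ⟨γ, hγ, rfl, rfl⟩ := h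
  refine mem_liftLeaf_of_path (γ := g ∘ γ) (hg.comp γ.continuous) ?_
  rwa [← Function.comp_assoc, hpg]

theorem eventually_mem_liftLeaf (hp : IsLocalHomeomorph p) {φ} (hφ : φ ∈ W.charts) {x : M'}
    (hx : p x ∈ φ.source) : ∀ᶠ y : M' × M' in 𝓝 (x, x),
      (φ (p y.1)).2 = (φ (p y.2)).2 → y.2 ∈ W.liftLeaf p y.1 := by
  filter_upwards [eventually_exists_isLeafPath hp hφ hx univ_mem] with y hy h
  obtain ⟨γ, hγ, hl, h0, h1, -⟩ := hy h
  rw [← h0, ← h1]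
  exact mem_liftLeaf_of_path hγ hl

end Foliation

/-! ### Fields of tangent subspaces in coordinates -/

section Coordinates

variable {d : ℕ} {M : Type u} [TopologicalSpace M] [ChartedSpace (EuclideanSpace ℝ (Fin d)) M]
  [IsManifold (𝓡 d) ∞ M]

/-- The identification of tangent spaces near `m` with `ℝ^d` given by the chart at `m`. -/
noncomputable def tangentCoord (m y : M) :
    TangentSpace (𝓡 d) y →L[ℝ] EuclideanSpace ℝ (Fin d) :=
  (trivializationAt (EuclideanSpace ℝ (Fin d)) (TangentSpace (𝓡 d)) m).continuousLinearMapAt ℝ y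

theorem tangentCoord_bijective {m y : M}
    (hy : y ∈ (chartAt (EuclideanSpace ℝ (Fin d)) m).source) :
    Function.Bijective (tangentCoord (d := d) m y) := by
  have h : y ∈ (trivializationAt (EuclideanSpace ℝ (Fin d)) (TangentSpace (𝓡 d)) m).baseSet := by
    rwa [TangentBundle.trivializationAt_baseSet]
  rw [tangentCoord, ← Trivialization.coe_continuousLinearEquivAt_eq _ h]
  exact ContinuousLinearEquiv.bijective _

theorem tangentCoord_eq_mfderiv {m y : M}
    (hy : y ∈ (chartAt (EuclideanSpace ℝ (Fin d)) m).source) :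
    tangentCoord m y = mfderiv (𝓡 d) 𝓘(ℝ, EuclideanSpace ℝ (Fin d)) (extChartAt (𝓡 d) m) y :=
  TangentBundle.continuousLinearMapAt_trivializationAt hy

/-- A field of tangent subspaces near `m`, read in the chart at `m`. -/
noncomputable def coordSubspace (E : (x : M) → Submodule ℝ (TangentSpace (𝓡 d) x)) (m y : M) :
    Submodule ℝ (EuclideanSpace ℝ (Fin d)) :=
  (E y).map (tangentCoord m y).toLinearMap

theorem coordSubspace_sup (E E' : (x : M) → Submodule ℝ (TangentSpace (𝓡 d) x)) (m y : M) :
    coordSubspace (fun x => E x ⊔ E' x) m y = coordSubspace E m y ⊔ coordSubspace E' m y :=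
  Submodule.map_sup _ _ _

theorem coordSubspace_mono {E E' : (x : M) → Submodule ℝ (TangentSpace (𝓡 d) x)} {m y : M}
    (h : E y ≤ E' y) : coordSubspace E m y ≤ coordSubspace E' m y :=
  Submodule.map_mono h

theorem disjoint_coordSubspace {E E' : (x : M) → Submodule ℝ (TangentSpace (𝓡 d) x)} {m : M}
    (h : Disjoint (E m) (E' m)) : Disjoint (coordSubspace E m m) (coordSubspace E' m m) :=
  Submodule.disjoint_map (tangentCoord_bijective (mem_chart_source _ m)).1 h

theorem isCompl_coordSubspace {E E' : (x : M) → Submodule ℝ (TangentSpace (𝓡 d) x)} {m : M}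
    (h : IsCompl (E m) (E' m)) : IsCompl (coordSubspace E m m) (coordSubspace E' m m) := by
  refine ⟨disjoint_coordSubspace h.1, codisjoint_iff.2 ?_⟩
  rw [coordSubspace, coordSubspace, ← Submodule.map_sup, h.sup_eq_top, Submodule.map_top]
  exact LinearMap.range_eq_top.2 (tangentCoord_bijective (mem_chart_source _ m)).2

/-- `e` is a frame for `E` near `m`, continuous at `m`, in the coordinates of the chart at `m`. -/
structure IsFrameAt {ι : Type*} (E : (x : M) → Submodule ℝ (TangentSpace (𝓡 d) x)) (m : M)
    (e : M → ι → EuclideanSpace ℝ (Fin d)) : Prop where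
  continuousAt : ContinuousAt e m
  linearIndependent : LinearIndependent ℝ (e m)
  span_eq : ∀ᶠ y in 𝓝 m, Submodule.span ℝ (range (e y)) = coordSubspace E m y

theorem IsContinuousSubbundle.exists_isFrameAt
    {E : (x : M) → Submodule ℝ (TangentSpace (𝓡 d) x)} (hE : IsContinuousSubbundle E) (m : M) :
    ∃ (k : ℕ) (e : M → Fin k → EuclideanSpace ℝ (Fin d)), IsFrameAt E m e := by
  obtain ⟨k, U, hU, v, hv, hspan⟩ := hE m
  have hm := mem_chart_source (EuclideanSpace ℝ (Fin d)) m
  refine ⟨k, fun y i => tangentCoord m y (v i y), ?_, ?_, ?_⟩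
  · rw [continuousAt_pi]
    intro i
    let t := trivializationAt (EuclideanSpace ℝ (Fin d)) (TangentSpace (𝓡 d) (M := M)) m
    have hb : m ∈ t.baseSet := by
      rw [TangentBundle.trivializationAt_baseSet]; exact hm
    have h1 : ContinuousAt (fun y => (⟨y, v i y⟩ : TangentBundle (𝓡 d) M)) m :=
      (hv i).continuousAt hU
    have h2 : ContinuousAt (fun y => (t ⟨y, v i y⟩).2) m :=
      (ContinuousAt.comp (f := fun y => (⟨y, v i y⟩ : TangentBundle (𝓡 d) M)) (g := t)
        (t.continuousOn.continuousAt (t.open_source.mem_nhds (t.mem_source.2 hb))) h1).snd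
    refine h2.congr ?_
    filter_upwards [t.open_baseSet.mem_nhds hb] with y hy
    exact (Trivialization.continuousLinearMapAt_apply_of_mem ℝ t hy (v i y)).symm
  · have := (hspan m (mem_of_mem_nhds hU)).1
    exact this.map' (tangentCoord m m).toLinearMap
      (LinearMap.ker_eq_bot.2 (tangentCoord_bijective hm).1)
  · filter_upwards [hU] with y hy
    rw [coordSubspace, ← (hspan y hy).2, Submodule.map_span, ← range_comp]
    rfl

theorem IsFrameAt.span_self {ι : Type*} {E : (x : M) → Submodule ℝ (TangentSpace (𝓡 d) x)} {m : M}
    {e : M → ι → EuclideanSpace ℝ (Fin d)} (he : IsFrameAt E m e) :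
    Submodule.span ℝ (range (e m)) = coordSubspace E m m :=
  he.span_eq.self_of_nhds

theorem IsFrameAt.finrank {ι : Type*} [Fintype ι]
    {E : (x : M) → Submodule ℝ (TangentSpace (𝓡 d) x)} {m : M}
    {e : M → ι → EuclideanSpace ℝ (Fin d)} (he : IsFrameAt E m e) :
    Module.finrank ℝ (coordSubspace E m m) = Fintype.card ι := by
  rw [← he.span_self, finrank_span_eq_card he.linearIndependent]

theorem IsFrameAt.sup {ι κ : Type*} {E E' : (x : M) → Submodule ℝ (TangentSpace (𝓡 d) x)} {m : M}
    {e : M → ι → EuclideanSpace ℝ (Fin d)} {e' : M → κ → EuclideanSpace ℝ (Fin d)}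
    (he : IsFrameAt E m e) (he' : IsFrameAt E' m e') (h : Disjoint (E m) (E' m)) :
    IsFrameAt (fun x => E x ⊔ E' x) m (fun y => Sum.elim (e y) (e' y)) where
  continuousAt := by
    rw [continuousAt_pi]
    rintro (i | i)
    exacts [continuousAt_pi.1 he.continuousAt i, continuousAt_pi.1 he'.continuousAt i]
  linearIndependent := by
    refine he.linearIndependent.sum_type he'.linearIndependent ?_
    rw [he.span_self, he'.span_self]
    exact disjoint_coordSubspace h
  span_eq := by
    filter_upwards [he.span_eq, he'.span_eq] with y h1 h2
    rw [coordSubspace_sup, ← h1, ← h2, Sum.elim_range, Submodule.span_union]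

end Coordinates

/-! ### Plaques in coordinates and local product structure. -/

namespace Foliation

variable {d : ℕ} {M : Type u} [TopologicalSpace M] [ChartedSpace (EuclideanSpace ℝ (Fin d)) M]
  {W : Foliation d M}

/-- Coordinates are swapped, transverse before leafwise, to match `IsImmersedFamilyAt`, where the
parameter of the disc comes first. -/
theorem eventually_target_source {φ : OpenPartialHomeomorph M
    (EuclideanSpace ℝ (Fin W.dim) × EuclideanSpace ℝ (Fin W.codim))} {m : M} (hm : m ∈ φ.source)
    {N : Set M} (hN : N ∈ 𝓝 m) :
    ∀ᶠ z in 𝓝 ((φ m).2, (φ m).1), (z.2, z.1) ∈ φ.target ∧ φ.symm (z.2, z.1) ∈ N ∧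
      φ.symm (z.2, z.1) ∈ (chartAt (EuclideanSpace ℝ (Fin d)) m).source := by
  have hs : Tendsto (Prod.swap : EuclideanSpace ℝ (Fin W.codim) × EuclideanSpace ℝ (Fin W.dim) → _)
    (𝓝 ((φ m).2, (φ m).1)) (𝓝 (φ m)) := continuous_swap.tendsto ((φ m).2, (φ m).1)
  have h1 : Tendsto φ.symm (𝓝 (φ m)) (𝓝 m) := by
    simpa [φ.left_inv hm] using (φ.continuousAt_symm (φ.map_source hm)).tendsto
  refine Eventually.and (hs (φ.open_target.mem_nhds (φ.map_source hm)))
    (Eventually.and (hs (h1 hN)) (hs (h1 ?_)))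
  exact (chartAt _ m).open_source.mem_nhds (mem_chart_source _ m)

variable [IsManifold (𝓡 d) ∞ M]
  {E : (x : M) → Submodule ℝ (TangentSpace (𝓡 d) x)}

theorem contDiffAt_plaque {φ} (hφ : φ ∈ W.charts) {m : M} {z} (hz : z ∈ φ.target)
    (hm : φ.symm z ∈ (chartAt (EuclideanSpace ℝ (Fin d)) m).source) :
    ContDiffAt ℝ 1 (fun a => extChartAt (𝓡 d) m (φ.symm (a, z.2))) z.1 := by
  have ho : IsOpen {a | (a, z.2) ∈ φ.target} := φ.open_target.preimage (by fun_prop)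
  have h1 : ContMDiffAt (𝓡 W.dim) (𝓡 d) 1 (fun a => φ.symm (a, z.2)) z.1 :=
    (W.contMDiffOn_plaque φ hφ z.2).contMDiffAt (ho.mem_nhds hz)
  have h2 : ContMDiffAt (𝓡 d) 𝓘(ℝ, EuclideanSpace ℝ (Fin d)) 1 (extChartAt (𝓡 d) m)
    (φ.symm (z.1, z.2)) := contMDiffAt_extChartAt' hm
  exact contMDiffAt_iff_contDiffAt.1 (h2.comp z.1 (f := fun a => φ.symm (a, z.2)) h1)

theorem fderiv_plaque {φ} (hφ : φ ∈ W.charts) {m : M} {z} (hz : z ∈ φ.target)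
    (hm : φ.symm z ∈ (chartAt (EuclideanSpace ℝ (Fin d)) m).source) :
    fderiv ℝ (fun a => extChartAt (𝓡 d) m (φ.symm (a, z.2))) z.1 =
      (tangentCoord m (φ.symm (z.1, z.2))).comp
        (mfderiv (𝓡 W.dim) (𝓡 d) (fun a => φ.symm (a, z.2)) z.1) := by
  have ho : IsOpen {a | (a, z.2) ∈ φ.target} := φ.open_target.preimage (by fun_prop)
  have h1 : ContMDiffAt (𝓡 W.dim) (𝓡 d) 1 (fun a => φ.symm (a, z.2)) z.1 :=
    (W.contMDiffOn_plaque φ hφ z.2).contMDiffAt (ho.mem_nhds hz)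
  have h2 : ContMDiffAt (𝓡 d) 𝓘(ℝ, EuclideanSpace ℝ (Fin d)) 1 (extChartAt (𝓡 d) m)
    (φ.symm (z.1, z.2)) := contMDiffAt_extChartAt' hm
  rw [← mfderiv_eq_fderiv, tangentCoord_eq_mfderiv hm]
  exact mfderiv_comp z.1 (f := fun a => φ.symm (a, z.2)) (h2.mdifferentiableAt one_ne_zero)
    (h1.mdifferentiableAt one_ne_zero)

theorem IsTangentTo.range_fderiv (hW : W.IsTangentTo E) {φ} (hφ : φ ∈ W.charts) {m : M} {z}
    (hz : z ∈ φ.target) (hm : φ.symm z ∈ (chartAt (EuclideanSpace ℝ (Fin d)) m).source) :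
    (fderiv ℝ (fun a => extChartAt (𝓡 d) m (φ.symm (a, z.2))) z.1).range =
      coordSubspace E m (φ.symm z) := by
  rw [fderiv_plaque hφ hz hm, coordSubspace, ← (hW φ hφ z hz).2]
  exact LinearMap.range_comp _ _

theorem IsTangentTo.injective_fderiv (hW : W.IsTangentTo E) {φ} (hφ : φ ∈ W.charts) {m : M} {z}
    (hz : z ∈ φ.target) (hm : φ.symm z ∈ (chartAt (EuclideanSpace ℝ (Fin d)) m).source) :
    Function.Injective (fderiv ℝ (fun a => extChartAt (𝓡 d) m (φ.symm (a, z.2))) z.1) := by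
  rw [fderiv_plaque hφ hz hm]
  exact (tangentCoord_bijective hm).1.comp (hW φ hφ z hz).1

theorem IsTangentTo.finrank_eq (hW : W.IsTangentTo E) (m : M) :
    Module.finrank ℝ (coordSubspace E m m) = W.dim := by
  obtain ⟨φ, hφ, hm⟩ := W.exists_chart m
  have hs : φ.symm (φ m) ∈ (chartAt (EuclideanSpace ℝ (Fin d)) m).source := by
    rw [φ.left_inv hm]; exact mem_chart_source _ m
  have h1 := hW.range_fderiv hφ (φ.map_source hm) hs
  rw [φ.left_inv hm] at h1
  rw [← h1, LinearMap.finrank_range_of_inj (hW.injective_fderiv hφ (φ.map_source hm) hs)]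
  simp

/-- The plaques of a foliation tangent to a continuous subbundle, in coordinates. -/
theorem IsTangentTo.isImmersedFamilyAt (hW : W.IsTangentTo E) {ι : Type*} [Fintype ι] {m : M}
    {e : M → ι → EuclideanSpace ℝ (Fin d)} (he : IsFrameAt E m e) {φ} (hφ : φ ∈ W.charts)
    (hm : m ∈ φ.source) :
    IsImmersedFamilyAt
      (fun z : EuclideanSpace ℝ (Fin W.codim) × EuclideanSpace ℝ (Fin W.dim) =>
        extChartAt (𝓡 d) m (φ.symm (z.2, z.1)))
      (fun z => e (φ.symm (z.2, z.1))) ((φ m).2, (φ m).1) where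
  continuousAt := by
    filter_upwards [eventually_target_source hm univ_mem] with z ⟨h1, _, h2⟩
    have h3 : ContinuousAt (fun z : EuclideanSpace ℝ (Fin W.codim) × EuclideanSpace ℝ (Fin W.dim)
        => φ.symm (z.2, z.1)) z :=
      ContinuousAt.comp (f := Prod.swap) (φ.continuousAt_symm h1) (by fun_prop)
    exact ContinuousAt.comp (g := extChartAt (𝓡 d) m) (continuousAt_extChartAt'
      (by rwa [extChartAt_source])) h3
  contDiffAt := by
    filter_upwards [eventually_target_source hm univ_mem] with z ⟨h1, _, h2⟩
    exact contDiffAt_plaque hφ h1 h2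
  range_fderiv := by
    filter_upwards [eventually_target_source hm he.span_eq] with z ⟨h1, h3, h2⟩
    exact (hW.range_fderiv hφ h1 h2).trans h3.symm
  continuousAt_frame := by
    have h3 : ContinuousAt (fun z : EuclideanSpace ℝ (Fin W.codim) × EuclideanSpace ℝ (Fin W.dim)
        => φ.symm (z.2, z.1)) ((φ m).2, (φ m).1) :=
      ContinuousAt.comp (f := Prod.swap)
        (φ.continuousAt_symm (φ.map_source hm)) (by fun_prop)
    refine ContinuousAt.comp (g := e) ?_ h3
    simp only [Prod.mk.eta, φ.left_inv hm]
    exact he.continuousAt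
  finrank_eq := by rw [← he.finrank, hW.finrank_eq]; simp

/-- Local product structure: plaques of foliations tangent to complementary subbundles
intersect. -/
theorem IsTangentTo.eventually_exists_inter {W' : Foliation d M}
    {E' : (x : M) → Submodule ℝ (TangentSpace (𝓡 d) x)} (hW : W.IsTangentTo E)
    (hW' : W'.IsTangentTo E') {ι κ : Type*} [Fintype ι] [Fintype κ] {m : M}
    {e : M → ι → EuclideanSpace ℝ (Fin d)} {e' : M → κ → EuclideanSpace ℝ (Fin d)}
    (he : IsFrameAt E m e) (he' : IsFrameAt E' m e') (hc : IsCompl (E m) (E' m))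
    {φ} (hφ : φ ∈ W.charts) (hm : m ∈ φ.source) {ψ} (hψ : ψ ∈ W'.charts) (hm' : m ∈ ψ.source)
    {N : Set M} (hN : N ∈ 𝓝 m) :
    ∀ᶠ y in 𝓝 (m, m), ∃ r ∈ N, (φ r).2 = (φ y.1).2 ∧ (ψ r).2 = (ψ y.2).2 := by
  have h1 := eventually_target_source (W := W) hm hN
  have h2 := eventually_target_source (W := W') hm' univ_mem
  rw [nhds_prod_eq] at h1 h2
  obtain ⟨P, hP, A, hA, hPA⟩ := eventually_prod_iff.1 h1
  obtain ⟨Q, hQ, B, hB, hQB⟩ := eventually_prod_iff.1 h2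
  have hcc := isCompl_coordSubspace hc
  have key := (hW.isImmersedFamilyAt he hφ hm).eventually_exists_eq
    (hW'.isImmersedFamilyAt he' hψ hm') (by simp [φ.left_inv hm, ψ.left_inv hm'])
    (by
      simp only [Prod.mk.eta, φ.left_inv hm, ψ.left_inv hm']
      refine he.linearIndependent.sum_type he'.linearIndependent ?_
      rw [he.span_self, he'.span_self]
      exact hcc.1)
    (by rw [← he.finrank, ← he'.finrank, Submodule.finrank_add_eq_of_isCompl hcc])
    (prod_mem_nhds hA hB)
  have hc1 : Tendsto (fun y : M × M => ((φ y.1).2, (ψ y.2).2)) (𝓝 (m, m))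
      (𝓝 ((φ m).2, (ψ m).2)) :=
    ContinuousAt.prodMk
      (ContinuousAt.snd (ContinuousAt.comp (f := Prod.fst) (φ.continuousAt hm) continuousAt_fst))
      (ContinuousAt.snd (ContinuousAt.comp (f := Prod.snd) (ψ.continuousAt hm') continuousAt_snd))
  filter_upwards [hc1.eventually key, hc1.eventually (hP.prod_nhds hQ)]
    with y ⟨⟨a, b⟩, ⟨ha, hb⟩, hab⟩ ⟨hy1, hy2⟩
  simp only at ha hb hab hy1 hy2
  obtain ⟨ht, hN', hs⟩ := hPA hy1 ha
  obtain ⟨ht', -, hs'⟩ := hQB hy2 hb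
  -- The discs were intersected in the chart of `M` at m; injectivity of that chart gives a common
  -- point in `M`.
  have heq : φ.symm (a, (φ y.1).2) = ψ.symm (b, (ψ y.2).2) :=
    (extChartAt (𝓡 d) m).injOn (by rwa [extChartAt_source]) (by rwa [extChartAt_source]) hab
  refine ⟨_, hN', ?_, ?_⟩
  · rw [φ.right_inv ht]
  · rw [heq, ψ.right_inv ht']

end Foliation

/-! ### Chords of immersed discs. -/

section StrictDerivative

variable {A B V : Type*} [NormedAddCommGroup A] [NormedSpace ℝ A] [FiniteDimensional ℝ A]
  [NormedAddCommGroup B] [NormedSpace ℝ B] [FiniteDimensional ℝ B]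
  [NormedAddCommGroup V]

/-- Chords of an immersed disc are nearly annihilated by the linear maps that vanish on its
tangent space. -/
theorem HasStrictFDerivAt.isLittleO_of_comp_eq_zero [NormedSpace ℝ V] {V' : Type*}
    [NormedAddCommGroup V'] [NormedSpace ℝ V'] {h : A → V} {L : A →L[ℝ] V} {a : A}
    (hh : HasStrictFDerivAt h L a) (hL : Function.Injective L) (S : V →L[ℝ] V')
    (hS : ∀ x, S (L x) = 0) :
    (fun z : A × A => S (h z.1 - h z.2)) =o[𝓝 (a, a)] fun z : A × A => h z.1 - h z.2 := by
  have h1 : (fun z : A × A => S (h z.1 - h z.2)) =o[𝓝 (a, a)] fun z : A × A => z.1 - z.2 := by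
    have := (S.isBigO_comp (fun z : A × A => h z.1 - h z.2 - L (z.1 - z.2)) (𝓝 (a, a))).trans_isLittleO
      hh.isLittleO
    refine this.congr_left fun z => ?_
    rw [map_sub S, hS, sub_zero]
  -- Injectivity of L makes chord length comparable to parameter distance, which turns o(z.1 - z.2)
  -- into o of the chord.
  have hind : Topology.IsInducing L := by
    obtain ⟨K, -, hanti⟩ := L.toLinearMap.exists_antilipschitzWith (LinearMap.ker_eq_bot.2 hL)
    exact (hanti.isUniformInducing L.uniformContinuous).isInducing
  exact h1.trans_isBigO (hh.isTheta_sub hind).2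

/-- Two immersed discs and a linear subspace, whose tangent spaces meet trivially, have no
common short chords. -/
theorem eventually_eq_zero_of_common_chord [InnerProductSpace ℝ V] [FiniteDimensional ℝ V]
    {h : A → V} {L : A →L[ℝ] V} {a : A}
    (hh : HasStrictFDerivAt h L a) (hL : Function.Injective L)
    {k : B → V} {K : B →L[ℝ] V} {b : B} (hk : HasStrictFDerivAt k K b)
    (hK : Function.Injective K) {F : Submodule ℝ V}
    (hF : ∀ x ∈ F, x ∈ L.range → x ∈ K.range → x = 0) :
    ∀ᶠ z in 𝓝 ((a, a), (b, b)), h z.1.1 - h z.1.2 = k z.2.1 - k z.2.2 →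
      h z.1.1 - h z.1.2 ∈ F → h z.1.1 = h z.1.2 := by
  -- S and T kill exactly the tangent spaces of the two discs, so the hypothesis on F says that (S,
  -- T) is injective on F, hence bounded below by 1 / C in finite dimension.
  let S : V →L[ℝ] V := (L.range)ᗮ.starProjection
  let T : V →L[ℝ] V := (K.range)ᗮ.starProjection
  have hS : ∀ x, S x = 0 ↔ x ∈ L.range := by
    intro x
    have : (S : V →ₗ[ℝ] V).ker = (L.range) := by
      rw [Submodule.ker_starProjection, Submodule.orthogonal_orthogonal]
    rw [← this]; rfl
  have hT : ∀ x, T x = 0 ↔ x ∈ K.range := by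
    intro x
    have : (T : V →ₗ[ℝ] V).ker = (K.range) := by
      rw [Submodule.ker_starProjection, Submodule.orthogonal_orthogonal]
    rw [← this]; rfl
  let Λ : F →ₗ[ℝ] V × V := (S.prod T).toLinearMap.comp F.subtype
  have hΛ : Λ.ker = ⊥ := by
    rw [LinearMap.ker_eq_bot']
    rintro ⟨x, hx⟩ h0
    have h0' : (S x, T x) = (0, 0) := h0
    rw [Prod.mk.injEq, hS, hT] at h0'
    exact Subtype.ext (hF x hx h0'.1 h0'.2)
  obtain ⟨C, hC, hanti⟩ := Λ.exists_antilipschitzWith hΛ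
  have hCpos : (0 : ℝ) < C := hC
  have o1 := (hh.isLittleO_of_comp_eq_zero hL S fun x => (hS _).2 ⟨x, rfl⟩).def
    -- With this constant a common chord x in F satisfies ‖x‖ ≤ C * (1 / (2 * C)) * ‖x‖ = ‖x‖ / 2,
    -- which forces x = 0.
    (c := 1 / (2 * C)) (by positivity)
  have o2 := (hk.isLittleO_of_comp_eq_zero hK T fun x => (hT _).2 ⟨x, rfl⟩).def
    (c := 1 / (2 * C)) (by positivity)
  rw [nhds_prod_eq]
  filter_upwards [o1.prod_mk o2] with z ⟨h1, h2⟩ heq hmem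
  rw [← heq] at h2
  set x := h z.1.1 - h z.1.2 with hx
  have h3 : ‖x‖ ≤ C * ‖Λ ⟨x, hmem⟩‖ := by
    simpa using hanti.le_mul_dist ⟨x, hmem⟩ 0
  have h4 : ‖Λ ⟨x, hmem⟩‖ ≤ 1 / (2 * C) * ‖x‖ := max_le h1 h2
  have h5 : ‖x‖ ≤ 1 / 2 * ‖x‖ := by
    refine h3.trans ((mul_le_mul_of_nonneg_left h4 hCpos.le).trans_eq ?_)
    field_simp
  have h6 : ‖x‖ = 0 := by linarith [norm_nonneg x]
  exact sub_eq_zero.1 (norm_eq_zero.1 h6)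

end StrictDerivative

/-! ### Plaques whose tangent spaces overlap: intersections with a complementary direction, and
subfoliations. -/

namespace Foliation

variable {d : ℕ} {M : Type u} [TopologicalSpace M] [ChartedSpace (EuclideanSpace ℝ (Fin d)) M]
  [IsManifold (𝓡 d) ∞ M] {W W' : Foliation d M}
  {E E' F : (x : M) → Submodule ℝ (TangentSpace (𝓡 d) x)}

/-- A plaque that contains a direction complementary to `W` meets all nearby plaques of `W`. -/
theorem IsTangentTo.eventually_exists_inter_of_le (hW : W.IsTangentTo E)
    (hW' : W'.IsTangentTo E') {ι : Type*} [Fintype ι] {m : M}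
    {e : M → ι → EuclideanSpace ℝ (Fin d)}
    (he : IsFrameAt E m e) (hF : F m ≤ E' m) (hc : IsCompl (E m) (F m))
    {φ} (hφ : φ ∈ W.charts) (hm : m ∈ φ.source) {ψ} (hψ : ψ ∈ W'.charts) (hm' : m ∈ ψ.source)
    {N : Set M} (hN : N ∈ 𝓝 m) :
    ∀ᶠ y in 𝓝 m, ∃ r ∈ N, (φ r).2 = (φ y).2 ∧ (ψ r).2 = (ψ m).2 := by
  have hcc := isCompl_coordSubspace hc
  have hm0 : ψ.symm (ψ m) ∈ (chartAt (EuclideanSpace ℝ (Fin d)) m).source := by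
    rw [ψ.left_inv hm']; exact mem_chart_source _ m
  set a₀ := (ψ m).1 with ha₀
  set c₀ := (ψ m).2 with hc₀
  let h : EuclideanSpace ℝ (Fin W'.dim) → EuclideanSpace ℝ (Fin d) :=
    fun a => extChartAt (𝓡 d) m (ψ.symm (a, c₀))
  let L := fderiv ℝ h a₀
  have hLinj : Function.Injective L := hW'.injective_fderiv hψ (ψ.map_source hm') hm0
  have hLr : L.range = coordSubspace E' m m := by
    have := hW'.range_fderiv hψ (ψ.map_source hm') hm0
    rwa [ψ.left_inv hm'] at this
  -- The tangent spaces E and E' may overlap, so the plaque of `W'` through m is cut down to the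
  -- slice a₀ + K, a disc tangent to F at m. It is a single disc, hence the trivial parameter space
  -- `Unit`.
  let K : Submodule ℝ (EuclideanSpace ℝ (Fin W'.dim)) := (coordSubspace F m m).comap L.toLinearMap
  have hK : K.map L.toLinearMap = coordSubspace F m m := by
    rw [Submodule.map_comap_eq]
    exact inf_eq_right.2 ((coordSubspace_mono hF).trans hLr.ge)
  let b := Module.finBasis ℝ K
  have h2 := eventually_target_source (W := W') hm' hN
  have hevK : ∀ᶠ z in 𝓝 (((), 0) : Unit × K), (a₀ + (z.2 : EuclideanSpace ℝ (Fin W'.dim)), c₀) ∈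
      ψ.target ∧ ψ.symm (a₀ + (z.2 : EuclideanSpace ℝ (Fin W'.dim)), c₀) ∈ N ∧
      ψ.symm (a₀ + (z.2 : EuclideanSpace ℝ (Fin W'.dim)), c₀) ∈
        (chartAt (EuclideanSpace ℝ (Fin d)) m).source := by
    have ht : Tendsto (fun z : Unit × K => (c₀, a₀ + (z.2 : EuclideanSpace ℝ (Fin W'.dim))))
        (𝓝 ((), 0)) (𝓝 (c₀, a₀)) := by
      have : Continuous fun z : Unit × K => (c₀, a₀ + (z.2 : EuclideanSpace ℝ (Fin W'.dim))) := by
        fun_prop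
      simpa using this.tendsto ((), 0)
    exact ht.eventually h2
  have hcd : ∀ {a}, (a, c₀) ∈ ψ.target →
      ψ.symm (a, c₀) ∈ (chartAt (EuclideanSpace ℝ (Fin d)) m).source → ContDiffAt ℝ 1 h a :=
    fun {a} h1 h2 => contDiffAt_plaque (z := (a, c₀)) hψ h1 h2
  have hβ : IsImmersedFamilyAt
      (fun z : Unit × K => h (a₀ + (z.2 : EuclideanSpace ℝ (Fin W'.dim))))
      (fun z i => fderiv ℝ h (a₀ + (z.2 : EuclideanSpace ℝ (Fin W'.dim))) (b i)) ((), 0) := by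
    refine ⟨?_, ?_, ?_, ?_, by simp⟩
    · filter_upwards [hevK] with z hz
      exact ContinuousAt.comp (g := h) (hcd hz.1 hz.2.2).continuousAt (by fun_prop)
    · filter_upwards [hevK] with z hz
      refine ContDiffAt.comp z.2 (g := h) (hcd hz.1 hz.2.2) ?_
      exact contDiffAt_const.add K.subtypeL.contDiff.contDiffAt
    · filter_upwards [hevK] with z hz
      have d1 := ((hcd hz.1 hz.2.2).differentiableAt one_ne_zero).hasFDerivAt
      have d2 : HasFDerivAt (fun x : K => a₀ + (x : EuclideanSpace ℝ (Fin W'.dim)))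
        K.subtypeL z.2 := K.subtypeL.hasFDerivAt.const_add a₀
      have d3 := (d1.comp z.2 d2).fderiv
      refine (congrArg (fun T : K →L[ℝ] EuclideanSpace ℝ (Fin d) => T.range) d3).trans ?_
      have : range (fun i => fderiv ℝ h (a₀ + (z.2 : EuclideanSpace ℝ (Fin W'.dim))) (b i)) =
          (((fderiv ℝ h (a₀ + (z.2 : EuclideanSpace ℝ (Fin W'.dim)))).comp K.subtypeL) :
            K →ₗ[ℝ] _) '' range b := by
        rw [← range_comp]; rfl
      rw [this, ← Submodule.map_span, b.span_eq, Submodule.map_top]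
    · have hc1 : ContinuousAt (fderiv ℝ h) (a₀ + ((0 : K) : EuclideanSpace ℝ (Fin W'.dim))) := by
        obtain ⟨q1, -, q2⟩ := hevK.self_of_nhds
        exact ((hcd q1 q2).fderiv_right (m := 0) (by norm_num)).continuousAt
      rw [continuousAt_pi]
      intro i
      have hc2 : ContinuousAt (fun z : Unit × K =>
          fderiv ℝ h (a₀ + (z.2 : EuclideanSpace ℝ (Fin W'.dim)))) ((), 0) :=
        ContinuousAt.comp (g := fderiv ℝ h) hc1 (by fun_prop)
      exact hc2.clm_apply continuousAt_const
  have hLb : LinearIndependent ℝ (fun i => L (b i)) :=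
    (b.linearIndependent.map' K.subtype K.ker_subtype).map' L.toLinearMap
      (LinearMap.ker_eq_bot.2 hLinj)
  have hLspan : Submodule.span ℝ (range fun i => L (b i)) = coordSubspace F m m := by
    have : range (fun i => L (b i)) = (L.toLinearMap.comp K.subtype) '' range b := by
      rw [← range_comp]; rfl
    rw [this, ← Submodule.map_span, b.span_eq, Submodule.map_comp, Submodule.map_subtype_top, hK]
  have h1 := eventually_target_source (W := W) hm univ_mem
  rw [nhds_prod_eq] at h1
  obtain ⟨P, hP, A, hA, hPA⟩ := eventually_prod_iff.1 h1
  have hB : ∀ᶠ x in 𝓝 (0 : K), _ :=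
    (Continuous.tendsto (f := fun x : K => ((), x)) (by fun_prop) 0).eventually hevK
  have key := (hW.isImmersedFamilyAt he hφ hm).eventually_exists_eq hβ
    (by simp [h, φ.left_inv hm, ha₀, hc₀, ψ.left_inv hm'])
    (by
      simp only [Prod.mk.eta, φ.left_inv hm, ZeroMemClass.coe_zero, add_zero]
      refine he.linearIndependent.sum_type hLb ?_
      rw [he.span_self]
      exact hcc.1.mono_right hLspan.le)
    (by
      rw [← Submodule.finrank_add_eq_of_isCompl hcc, he.finrank, ← hLspan,
        finrank_span_eq_card hLb])
    (prod_mem_nhds hA hB)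
  have hc1 : Tendsto (fun y : M => ((φ y).2, ())) (𝓝 m) (𝓝 ((φ m).2, ())) :=
    (φ.continuousAt hm).snd.prodMk continuousAt_const
  filter_upwards [hc1.eventually key, (φ.continuousAt hm).snd.eventually hP]
    with y ⟨⟨a, x⟩, ⟨ha, hx⟩, hab⟩ hy
  obtain ⟨ht, -, hs⟩ := hPA hy ha
  obtain ⟨ht', hN', hs'⟩ := hx
  have heq : φ.symm (a, (φ y).2) = ψ.symm (a₀ + (x : EuclideanSpace ℝ (Fin W'.dim)), c₀) :=
    (extChartAt (𝓡 d) m).injOn (by rwa [extChartAt_source]) (by rwa [extChartAt_source]) hab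
  refine ⟨_, hN', ?_, ?_⟩
  · rw [← heq, φ.right_inv ht]
  · rw [ψ.right_inv ht']

/-- Plaques of a subfoliation are locally contained in plaques. -/
theorem IsSubfoliation.eventually_snd_eq {d : ℕ} {M : Type u} [TopologicalSpace M]
    [ChartedSpace (EuclideanSpace ℝ (Fin d)) M] {W₀ W₁ : Foliation d M}
    (h : W₀.IsSubfoliation W₁) {m : M}
    {φ₀} (hφ₀ : φ₀ ∈ W₀.charts) (hm₀ : m ∈ φ₀.source)
    {φ₁} (hφ₁ : φ₁ ∈ W₁.charts) (hm₁ : m ∈ φ₁.source) :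
    ∀ᶠ y in 𝓝 m, (φ₀ y).2 = (φ₀ m).2 → (φ₁ y).2 = (φ₁ m).2 := by
  have h1 := eventually_exists_isLeafPath (W := W₀) (p := id)
    (Homeomorph.refl M).isLocalHomeomorph hφ₀ hm₀ (φ₁.open_source.mem_nhds hm₁)
  have h2 : Tendsto (fun y : M => (y, m)) (𝓝 m) (𝓝 (m, m)) :=
    (Continuous.tendsto (by fun_prop) m : Tendsto (fun y : M => (y, m)) (𝓝 m) (𝓝 (m, m)))
  filter_upwards [h2.eventually h1] with y hy heq
  obtain ⟨γ, -, hγ, h0, h1, hs⟩ := hy heq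
  rw [← h0, ← h1]
  exact (h _ hγ).snd_eq hφ₁ isPreconnected_univ (fun s _ => hs s) (mem_univ _) (mem_univ _)

/-- Locally the plaques of `W₁` and `W₂` intersect in plaques of the foliation `W₀`, if
the latter is a subfoliation of both and has complementary tangent spaces. -/
theorem IsTangentTo.eventually_snd_eq_of_snd_eq {W₀ W₁ W₂ : Foliation d M}
    {E₀ E₁ E₂ : (x : M) → Submodule ℝ (TangentSpace (𝓡 d) x)} (hW₀ : W₀.IsTangentTo E₀)
    (hW₁ : W₁.IsTangentTo E₁) (hW₂ : W₂.IsTangentTo E₂) (h₁ : W₀.IsSubfoliation W₁)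
    (h₂ : W₀.IsSubfoliation W₂) {ι : Type*} [Fintype ι] {m : M}
    {e : M → ι → EuclideanSpace ℝ (Fin d)} (he : IsFrameAt E₀ m e) (hc : IsCompl (E₀ m) (F m))
    (hF : F m ⊓ E₁ m ⊓ E₂ m = ⊥)
    {φ₀} (hφ₀ : φ₀ ∈ W₀.charts) (hm₀ : m ∈ φ₀.source)
    {φ₁} (hφ₁ : φ₁ ∈ W₁.charts) (hm₁ : m ∈ φ₁.source)
    {φ₂} (hφ₂ : φ₂ ∈ W₂.charts) (hm₂ : m ∈ φ₂.source) :
    ∀ᶠ y in 𝓝 m, (φ₁ y).2 = (φ₁ m).2 → (φ₂ y).2 = (φ₂ m).2 → (φ₀ y).2 = (φ₀ m).2 := by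
  have hcc := isCompl_coordSubspace hc
  set F' := coordSubspace F m m with hF'
  let χ := extChartAt (𝓡 d) m
  let b := Module.finBasis ℝ F'
  have hm := mem_chart_source (EuclideanSpace ℝ (Fin d)) m
  -- These are the affine subspaces parallel to F', parametrized by a base point. The one through y
  -- will be intersected with the plaque of `W₀` through m.
  have hβ : IsImmersedFamilyAt (fun z : EuclideanSpace ℝ (Fin d) × F' => z.1 + (z.2 : _))
      (fun _ i => ((b i : F') : EuclideanSpace ℝ (Fin d))) (χ m, 0) := by
    refine ⟨Eventually.of_forall fun z => by fun_prop, Eventually.of_forall fun z => ?_,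
      Eventually.of_forall fun z => ?_, continuousAt_const, by simp⟩
    · exact contDiffAt_const.add F'.subtypeL.contDiff.contDiffAt
    · have d2 : HasFDerivAt (fun x : F' => z.1 + (x : EuclideanSpace ℝ (Fin d)))
        F'.subtypeL z.2 := F'.subtypeL.hasFDerivAt.const_add z.1
      refine (congrArg (fun T : F' →L[ℝ] EuclideanSpace ℝ (Fin d) => T.range) d2.fderiv).trans ?_
      have : range (fun i => ((b i : F') : EuclideanSpace ℝ (Fin d))) =
          F'.subtype '' range b := by
        rw [← range_comp]; rfl
      rw [this, ← Submodule.map_span, b.span_eq, Submodule.map_top]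
      rfl
  have hbl : LinearIndependent ℝ (fun i => ((b i : F') : EuclideanSpace ℝ (Fin d))) :=
    b.linearIndependent.map' F'.subtype F'.ker_subtype
  have hbs : Submodule.span ℝ (range fun i => ((b i : F') : EuclideanSpace ℝ (Fin d))) = F' := by
    have : range (fun i => ((b i : F') : EuclideanSpace ℝ (Fin d))) = F'.subtype '' range b := by
      rw [← range_comp]; rfl
    rw [this, ← Submodule.map_span, b.span_eq, Submodule.map_top, Submodule.range_subtype]
  have hs : ∀ {W : Foliation d M} {φ : OpenPartialHomeomorph M
      (EuclideanSpace ℝ (Fin W.dim) × EuclideanSpace ℝ (Fin W.codim))}, m ∈ φ.source →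
      φ.symm (φ m) ∈ (chartAt (EuclideanSpace ℝ (Fin d)) m).source := by
    intro W φ h
    rwa [φ.left_inv h]
  have r1 := hW₁.range_fderiv hφ₁ (φ₁.map_source hm₁) (hs hm₁)
  have r2 := hW₂.range_fderiv hφ₂ (φ₂.map_source hm₂) (hs hm₂)
  rw [φ₁.left_inv hm₁] at r1
  rw [φ₂.left_inv hm₂] at r2
  have hchord := eventually_eq_zero_of_common_chord (F := F')
    ((contDiffAt_plaque hφ₁ (φ₁.map_source hm₁) (hs hm₁)).hasStrictFDerivAt one_ne_zero)
    (hW₁.injective_fderiv hφ₁ (φ₁.map_source hm₁) (hs hm₁))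
    ((contDiffAt_plaque hφ₂ (φ₂.map_source hm₂) (hs hm₂)).hasStrictFDerivAt one_ne_zero)
    (hW₂.injective_fderiv hφ₂ (φ₂.map_source hm₂) (hs hm₂)) (by
      intro x hx hx1 hx2
      rw [r1] at hx1
      rw [r2] at hx2
      obtain ⟨f, hf, rfl⟩ := hx
      obtain ⟨f1, hf1, hff1⟩ := hx1
      obtain ⟨f2, hf2, hff2⟩ := hx2
      have hinj := (tangentCoord_bijective hm).1
      obtain rfl := hinj hff1
      obtain rfl := hinj hff2
      have : f2 ∈ F m ⊓ E₁ m ⊓ E₂ m := ⟨⟨hf, hf1⟩, hf2⟩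
      rw [hF, Submodule.mem_bot] at this
      rw [this, map_zero])
  have hc1 : ContinuousAt (fun y => (φ₁ y).1) m := (φ₁.continuousAt hm₁).fst
  have hc2 : ContinuousAt (fun y => (φ₂ y).1) m := (φ₂.continuousAt hm₂).fst
  have ht : Tendsto (fun z : M × M => (((φ₁ z.1).1, (φ₁ z.2).1), ((φ₂ z.1).1, (φ₂ z.2).1)))
      (𝓝 (m, m)) (𝓝 (((φ₁ m).1, (φ₁ m).1), ((φ₂ m).1, (φ₂ m).1))) :=
    ((hc1.comp_of_eq continuousAt_fst rfl).prodMk (hc1.comp_of_eq continuousAt_snd rfl)).prodMk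
      ((hc2.comp_of_eq continuousAt_fst rfl).prodMk (hc2.comp_of_eq continuousAt_snd rfl))
  have hchord' := ht.eventually hchord
  rw [nhds_prod_eq] at hchord'
  obtain ⟨P, hP, Q, hQ, hPQ⟩ := eventually_prod_iff.1 hchord'
  have hN : ∀ᶠ t in 𝓝 m, P t ∧ t ∈ φ₁.source ∧ t ∈ φ₂.source ∧
      ((φ₀ t).2 = (φ₀ m).2 → (φ₁ t).2 = (φ₁ m).2) ∧
      ((φ₀ t).2 = (φ₀ m).2 → (φ₂ t).2 = (φ₂ m).2) :=
    hP.and (Eventually.and (φ₁.open_source.mem_nhds hm₁)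
      (Eventually.and (φ₂.open_source.mem_nhds hm₂)
      ((h₁.eventually_snd_eq hφ₀ hm₀ hφ₁ hm₁).and (h₂.eventually_snd_eq hφ₀ hm₀ hφ₂ hm₂))))
  have hN0 := eventually_target_source (W := W₀) hm₀ hN
  rw [nhds_prod_eq] at hN0
  obtain ⟨P0, hP0, A, hA, hPA⟩ := eventually_prod_iff.1 hN0
  have key := (hW₀.isImmersedFamilyAt he hφ₀ hm₀).eventually_exists_eq hβ
    (by simp [χ, φ₀.left_inv hm₀])
    (by
      simp only [Prod.mk.eta, φ₀.left_inv hm₀]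
      refine he.linearIndependent.sum_type hbl ?_
      rw [he.span_self]
      exact hcc.1.mono_right hbs.le)
    (by
      rw [← Submodule.finrank_add_eq_of_isCompl hcc, he.finrank, Fintype.card_fin])
    (prod_mem_nhds hA univ_mem)
  have hty : Tendsto (fun y : M => ((φ₀ m).2, χ y)) (𝓝 m) (𝓝 ((φ₀ m).2, χ m)) :=
    continuousAt_const.prodMk (continuousAt_extChartAt m)
  -- The intersection point t lies in the plaques of `W₁` and `W₂` through m, as does y. So the
  -- segment from y to t is a common chord with direction in F', and it degenerates: t = y.
  filter_upwards [hty.eventually key, hQ, φ₁.open_source.mem_nhds hm₁,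
    φ₂.open_source.mem_nhds hm₂, (chartAt (EuclideanSpace ℝ (Fin d)) m).open_source.mem_nhds hm]
    with y ⟨⟨a, x⟩, ⟨ha, _⟩, hax⟩ hQy hy1 hy2 hy e1 e2
  obtain ⟨htt, ⟨hPt, ht1, ht2, s1, s2⟩, hts⟩ := hPA hP0.self_of_nhds ha
  simp only at hax htt hPt ht1 ht2 s1 s2 hts
  set t := φ₀.symm (a, (φ₀ m).2) with ht_def
  have ht0 : (φ₀ t).2 = (φ₀ m).2 := by rw [ht_def, φ₀.right_inv htt]
  have hh := hPQ hPt hQy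
  have u1 : ∀ z ∈ φ₁.source, (φ₁ z).2 = (φ₁ m).2 → φ₁.symm ((φ₁ z).1, (φ₁ m).2) = z := by
    intro z hz hz2
    rw [← hz2, Prod.mk.eta, φ₁.left_inv hz]
  have u2 : ∀ z ∈ φ₂.source, (φ₂ z).2 = (φ₂ m).2 → φ₂.symm ((φ₂ z).1, (φ₂ m).2) = z := by
    intro z hz hz2
    rw [← hz2, Prod.mk.eta, φ₂.left_inv hz]
  simp only [u1 t ht1 (s1 ht0), u1 y hy1 e1, u2 t ht2 (s2 ht0), u2 y hy2 e2] at hh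
  have hmem : extChartAt (𝓡 d) m t - extChartAt (𝓡 d) m y ∈ F' := by
    have : extChartAt (𝓡 d) m t - extChartAt (𝓡 d) m y = x := by
      rw [hax]; exact add_sub_cancel_left _ _
    rw [this]; exact x.2
  have hty' : t = y := (extChartAt (𝓡 d) m).injOn (by rwa [extChartAt_source])
    (by rwa [extChartAt_source]) (hh trivial hmem)
  rw [← hty', ht0]

end Foliation

/-! ### Following leaf paths from nearby starting points. -/

namespace Foliation

variable {d : ℕ} {M : Type u} [TopologicalSpace M] [ChartedSpace (EuclideanSpace ℝ (Fin d)) M]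
  {W : Foliation d M} {M' : Type v} [TopologicalSpace M'] {p : M' → M}

/-- Inside one chart, α is followed by translating its leafwise coordinate so that it starts at w,
with the transverse coordinate of w. Compactness of the parameter interval gives closeness for all
times at once. -/
theorem IsLiftChart.eventually_exists_isLeafPath_near {ψ} (hψ : W.IsLiftChart p ψ)
    (hp : Continuous p) {α : unitInterval → M'} (hα : Continuous α) (hl : W.IsLeafPath (p ∘ α))
    {a b : unitInterval} (hab : a ≤ b) (hs : ∀ s ∈ Icc a b, α s ∈ ψ.source)
    {O : Set (unitInterval × M')} (hO : IsOpen O) (hαO : ∀ s, (s, α s) ∈ O) :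
    ∀ᶠ w in 𝓝 (α a), ∃ κ : unitInterval → M', Continuous κ ∧ W.IsLeafPath (p ∘ κ) ∧ κ a = w ∧
      ∀ s ∈ Icc a b, (s, κ s) ∈ O := by
  have ha : a ∈ Icc a b := ⟨le_rfl, hab⟩
  let G : M' × unitInterval →
      EuclideanSpace ℝ (Fin W.dim) × EuclideanSpace ℝ (Fin W.codim) :=
    fun z => ((ψ (α z.2)).1 + ((ψ z.1).1 - (ψ (α a)).1), (ψ z.1).2)
  have h2 : ∀ s ∈ Icc a b, (ψ (α s)).2 = (ψ (α a)).2 := by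
    intro s hsI
    obtain ⟨φ, hφ, hψφ⟩ := hψ
    rw [(hψφ _ (hs s hsI)).2, (hψφ _ (hs a ha)).2]
    exact hl.snd_eq hφ (isPreconnected_Icc (a := a) (b := b)) (fun s h => (hψφ _ (hs s h)).1) hsI ha
  have hG0 : ∀ s ∈ Icc a b, G (α a, s) = ψ (α s) := by
    intro s hsI
    simp only [G, sub_self, add_zero]
    rw [← h2 s hsI]
  have hev : ∀ᶠ w in 𝓝 (α a), ∀ s ∈ Icc a b, G (w, s) ∈ ψ.target ∧ (s, ψ.symm (G (w, s))) ∈ O := by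
    refine isCompact_Icc.eventually_forall_of_forall_eventually fun s hsI => ?_
    have c1 : ContinuousAt (fun z : M' × unitInterval => ψ (α z.2)) (α a, s) :=
      ContinuousAt.comp (f := fun z : M' × unitInterval => α z.2) (ψ.continuousAt (hs s hsI))
        (by fun_prop)
    have c2 : ContinuousAt (fun z : M' × unitInterval => ψ z.1) (α a, s) :=
      ContinuousAt.comp (f := fun z : M' × unitInterval => z.1) (ψ.continuousAt (hs a ha))
        (by fun_prop)
    have cG : ContinuousAt G (α a, s) :=
      (c1.fst.add (c2.fst.sub continuousAt_const)).prodMk c2.snd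
    have hmem : G (α a, s) ∈ ψ.target := by
      rw [hG0 s hsI]; exact ψ.map_source (hs s hsI)
    have c3 : ContinuousAt (fun z : M' × unitInterval => (z.2, ψ.symm (G z))) (α a, s) :=
      continuousAt_snd.prodMk (ContinuousAt.comp (ψ.continuousAt_symm hmem) cG)
    refine Eventually.and (cG.eventually (ψ.open_target.mem_nhds hmem))
      (c3.eventually (hO.mem_nhds ?_))
    simp only [hG0 s hsI, ψ.left_inv (hs s hsI)]
    exact hαO s
  filter_upwards [hev, ψ.open_source.mem_nhds (hs a ha)] with w hw hwψ
  -- Clamping time to [a, b] extends the path constantly to the whole unit interval.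
  let c : unitInterval → unitInterval := fun s => projIcc a b hab s
  have hc : Continuous c := (continuous_projIcc (h := hab)).subtype_val
  have hcI : ∀ s, c s ∈ Icc a b := fun s => (projIcc a b hab s).2
  have hcs : ∀ s ∈ Icc a b, c s = s := fun s h =>
    congrArg Subtype.val (projIcc_of_mem hab h)
  have hGc : Continuous fun s => G (w, c s) := by
    have : Continuous fun s => ψ (α (c s)) :=
      ψ.continuousOn.comp_continuous (hα.comp hc) fun s => hs _ (hcI s)
    have h1 : Continuous fun s => (ψ (α (c s))).1 + ((ψ w).1 - (ψ (α a)).1) :=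
      this.fst.add continuous_const
    exact h1.prodMk (continuous_const (y := (ψ w).2))
  have hκ : Continuous fun s => ψ.symm (G (w, c s)) :=
    ψ.continuousOn_symm.comp_continuous hGc fun s => (hw _ (hcI s)).1
  refine ⟨fun s => ψ.symm (G (w, c s)), hκ, ?_, ?_, fun s hsI => ?_⟩
  · refine hψ.isLeafPath hp hκ (fun t => ψ.map_target (hw _ (hcI t)).1) fun t => ?_
    rw [ψ.right_inv (hw _ (hcI t)).1, ψ.right_inv (hw _ (hcI 0)).1]
  · simp only [hcs a ha, G]
    rw [add_sub_cancel, Prod.mk.eta, ψ.left_inv hwψ]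
  · simp only [hcs s hsI]
    exact (hw s hsI).2

/-- Leaf paths can be followed from nearby starting points. -/
theorem eventually_exists_isLeafPath_near (hp : IsLocalHomeomorph p) {α : unitInterval → M'}
    (hα : Continuous α) (hl : W.IsLeafPath (p ∘ α)) {O : Set (unitInterval × M')} (hO : IsOpen O)
    (hαO : ∀ s, (s, α s) ∈ O) :
    ∀ᶠ z in 𝓝 (α 0), ∃ β : unitInterval → M', Continuous β ∧ W.IsLeafPath (p ∘ β) ∧ β 0 = z ∧
      ∀ s, (s, β s) ∈ O := by
  have hch : ∀ x : M', ∃ ψ, x ∈ ψ.source ∧ W.IsLiftChart p ψ := by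
    intro x
    obtain ⟨φ, hφ, hx⟩ := W.exists_chart (p x)
    obtain ⟨ψ, hxψ, -, -, hψ⟩ := exists_liftChart hp hφ hx
    exact ⟨ψ, hxψ, hψ⟩
  choose ψ hψx hψ using hch
  obtain ⟨t, ht0, htm, ⟨n₀, hn₀⟩, htc⟩ := exists_monotone_Icc_subset_open_cover_unitInterval
    (c := fun x : M' => α ⁻¹' (ψ x).source) (fun x => (ψ x).open_source.preimage hα)
    (fun s _ => mem_iUnion.2 ⟨α s, hψx (α s)⟩)
  have key : ∀ n, ∀ O : Set (unitInterval × M'), IsOpen O → (∀ s, (s, α s) ∈ O) →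
      ∀ᶠ z in 𝓝 (α 0), ∃ β : unitInterval → M', Continuous β ∧ W.IsLeafPath (p ∘ β) ∧ β 0 = z ∧
        ∀ s ≤ t n, (s, β s) ∈ O := by
    intro n
    induction n with
    | zero =>
      intro O hO hαO
      have h0 : ContinuousAt (fun z => ((0 : unitInterval), z)) (α 0) := by fun_prop
      filter_upwards [h0.eventually (hO.mem_nhds (hαO 0))] with z hz
      refine ⟨fun _ => z, continuous_const, isLeafPath_const _, rfl, fun s hs => ?_⟩
      rw [ht0] at hs
      rwa [le_antisymm hs s.2.1]
    | succ n ih =>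
      intro O hO hαO
      obtain ⟨x, hx⟩ := htc n
      have hle : t n ≤ t (n + 1) := htm n.le_succ
      obtain ⟨N, hN, hNo, hαN⟩ := eventually_nhds_iff.1
        ((hψ x).eventually_exists_isLeafPath_near hp.continuous hα hl hle hx hO hαO)
      -- Shrinking O only at time t n forces the path from the induction hypothesis to reach N then,
      -- where the continuation in the next chart is available.
      have hO' : IsOpen (O ∩ ({t n}ᶜ ×ˢ univ ∪ univ ×ˢ N)) :=
        hO.inter ((isOpen_compl_singleton.prod isOpen_univ).union (isOpen_univ.prod hNo))
      refine (ih _ hO' fun s => ⟨hαO s, ?_⟩).mono ?_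
      · by_cases hs : s = t n
        · right; subst hs; exact ⟨trivial, hαN⟩
        · left; exact ⟨hs, trivial⟩
      · rintro z ⟨β, hβ, hβl, hβ0, hβO⟩
        have hβN : β (t n) ∈ N := by
          rcases (hβO (t n) le_rfl).2 with h | h
          · exact absurd rfl h.1
          · exact h.2
        obtain ⟨κ, hκ, hκl, hκ0, hκO⟩ := hN _ hβN
        refine ⟨fun s => if s ≤ t n then β s else κ s, ?_, ?_, ?_, fun s hs => ?_⟩
        · refine hβ.if_le hκ continuous_id continuous_const fun s hs => ?_
          have hs' : s = t n := hs
          rw [hs', hκ0]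
        · have := hβl.if_le hκl (a := t n) (by simp [hκ0])
          refine (congrArg W.IsLeafPath ?_).mp this
          funext s
          simp only [Function.comp_apply, apply_ite p]
        · exact (if_pos (show (0 : unitInterval) ≤ t n from (t n).2.1)).trans hβ0
        · dsimp only
          split_ifs with h
          · exact (hβO s h).1
          · exact hκO s ⟨(not_le.1 h).le, hs⟩
  filter_upwards [key n₀ O hO hαO] with z ⟨β, h1, h2, h3, h4⟩
  exact ⟨β, h1, h2, h3, fun s => h4 s ((hn₀ n₀ le_rfl).symm ▸ s.2.2)⟩

/-- The saturation of an open set is open. -/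
theorem eventually_exists_mem_liftLeaf (hp : IsLocalHomeomorph p) {x z : M'}
    (hz : z ∈ W.liftLeaf p x) {N : Set M'} (hN : N ∈ 𝓝 z) :
    ∀ᶠ y in 𝓝 x, ∃ w ∈ N, w ∈ W.liftLeaf p y := by
  obtain ⟨α, hα, rfl, rfl⟩ := hz
  obtain ⟨N', hN', hNo, hz⟩ := mem_nhds_iff.1 hN
  -- This set restricts the path only at time 1, where it requires membership in N'.
  have hO : IsOpen (({1}ᶜ ×ˢ univ ∪ univ ×ˢ N') : Set (unitInterval × M')) :=
    (isOpen_compl_singleton.prod isOpen_univ).union (isOpen_univ.prod hNo)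
  refine (eventually_exists_isLeafPath_near hp α.continuous hα hO fun s => ?_).mono ?_
  · by_cases hs : s = 1
    · right; subst hs; exact ⟨trivial, hz⟩
    · left; exact ⟨hs, trivial⟩
  · rintro y ⟨β, hβ, hl, rfl, hβO⟩
    refine ⟨β 1, hN' ?_, mem_liftLeaf_of_path hβ hl⟩
    rcases hβO 1 with h | h
    · exact absurd rfl h.1
    · exact h.2

/-! ### Holonomy -/

/-- A diagonal choice. -/
theorem exists_forall_eventually_of_antitone {X Y : Type*} {F : Filter X} {P : ℕ → X → Y → Prop}
    [Nonempty Y] (hP : ∀ m n, m ≤ n → ∀ x y, P n x y → P m x y)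
    (hfin : ∀ x, ∃ n, ∀ y, ¬ P n x y) (hex : ∀ n, ∀ᶠ x in F, ∃ y, P n x y) :
    ∃ h : X → Y, ∀ n, ∀ᶠ x in F, P n x (h x) := by
  classical
  have : ∀ x, ∃ y, ∀ n, (∃ y', P n x y') → P n x y := by
    intro x
    -- k is the first level with no admissible y. A choice made at level k - 1 serves all lower
    -- levels by monotonicity; for k = 0 there is nothing to satisfy.
    let k := Nat.find (hfin x)
    have hk : ∀ n, (∃ y', P n x y') → n < k := by
      rintro n ⟨y', hy'⟩
      by_contra hcon
      exact Nat.find_spec (hfin x) y' (hP _ _ (not_lt.1 hcon) x y' hy')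
    rcases Nat.eq_zero_or_pos k with h0 | hpos
    · exact ⟨Classical.arbitrary Y, fun n hn => absurd (hk n hn) (by omega)⟩
    · have := Nat.find_min (hfin x) (Nat.sub_lt hpos one_pos)
      push Not at this
      obtain ⟨y, hy⟩ := this
      exact ⟨y, fun n hn => hP _ _ (by have := hk n hn; omega) x y hy⟩
  choose h hh using this
  exact ⟨h, fun n => (hex n).mono fun x hx => hh x n hx⟩

/-- Without holonomy, leaf paths close to a closed leaf curve that start and end on a transversal
are closed. -/
theorem WithoutHolonomy.eventually_apply_one_eq [T2Space M] [SecondCountableTopology M]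
    (hW : W.WithoutHolonomy) {α : C(unitInterval, M)} (hα : W.IsLeafPath α) (h1 : α 1 = α 0)
    {τ : Set M} (hτ : W.IsTransversal τ (α 0))
    (hex : ∀ U ∈ 𝓝 α, ∀ᶠ z in 𝓝[τ] (α 0), ∃ β ∈ U, W.IsLeafPath β ∧ β 0 = z ∧ β 1 ∈ τ) :
    ∃ U ∈ 𝓝 α, ∀ᶠ z in 𝓝[τ] (α 0), z ≠ α 0 →
      ∀ β ∈ U, W.IsLeafPath β → β 0 = z → β 1 ∈ τ → β 1 = z := by
  -- The hypothesis concerns holonomy maps, whereas the conclusion concerns all nearby paths. If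
  -- non-closing paths start at points z n → α 0, a holonomy representative h with h (z n) ≠ z n can
  -- be assembled from them, contradicting triviality of the germ.
  by_contra! hcon
  obtain ⟨U, hU⟩ := (𝓝 α).exists_antitone_basis
  obtain ⟨V, hV⟩ := (𝓝[τ] (α 0)).exists_antitone_basis
  have hbad : ∀ n, ∃ z ∈ V n, z ≠ α 0 ∧ ∃ β ∈ U n, W.IsLeafPath β ∧ β 0 = z ∧ β 1 ∈ τ ∧ β 1 ≠ z := by
    intro n
    have := (hcon (U n) (hU.mem n))
    obtain ⟨z, hz, hzV⟩ := (this.and_eventually (hV.mem n)).exists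
    exact ⟨z, hzV, hz⟩
  choose z hzV hz0 hzβ using hbad
  have hztend : Tendsto z atTop (𝓝[τ] (α 0)) := hV.tendsto hzV
  have hfar : ∀ n, ∀ᶠ x in 𝓝[τ] (α 0), ∀ k < n, x ≠ z k := by
    intro n
    have : IsOpen (z '' {k | k < n})ᶜ :=
      ((Set.finite_lt_nat n).image z).isClosed.isOpen_compl
    filter_upwards [mem_nhdsWithin_of_mem_nhds (this.mem_nhds (by
      rintro ⟨k, -, hk⟩
      exact hz0 k hk))] with x hx k hk hxk
    exact hx ⟨k, hk, hxk.symm⟩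
  -- Endpoints w reachable from x along `U n`-close paths, with the non-closing choice imposed at
  -- the bad points. The diagonal choice turns these into one map that works for all n.
  let P : ℕ → M → M → Prop := fun n x w => x ≠ α 0 ∧ (x ∈ range z → w ≠ x) ∧ w ∈ τ ∧
    ∃ β ∈ U n, W.IsLeafPath β ∧ β 0 = x ∧ β 1 = w
  obtain ⟨h, hh⟩ : ∃ h : M → M, ∀ n, ∀ᶠ x in 𝓝[τ] (α 0) ⊓ 𝓟 {α 0}ᶜ, P n x (h x) := by
    have : Nonempty M := ⟨α 0⟩
    refine exists_forall_eventually_of_antitone ?_ ?_ ?_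
    · rintro m n hmn x w ⟨hx, hxz, hw, β, hβ, h⟩
      exact ⟨hx, hxz, hw, β, hU.antitone hmn hβ, h⟩
    · intro x
      by_cases hx : x = α 0
      · exact ⟨0, fun w hw => hw.1 hx⟩
      -- A path starting at x ≠ α 0 cannot be arbitrarily close to α. This fails at α 0 itself,
      -- which is why that point is treated apart.
      · have hop : {β : C(unitInterval, M) | β 0 ≠ x} ∈ 𝓝 α :=
          (isOpen_compl_singleton.preimage (continuous_eval_const (0 : unitInterval))).mem_nhds
            (Ne.symm hx)
        obtain ⟨n, hn⟩ := hU.mem_iff.1 hop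
        refine ⟨n, ?_⟩
        rintro w ⟨-, -, -, β, hβ, -, h0, -⟩
        exact hn hβ h0
    · intro n
      filter_upwards [mem_inf_of_left (hex (U n) (hU.mem n)), mem_inf_of_left (hfar n),
        mem_inf_of_right (mem_principal_self _)] with x ⟨β, hβ, hl, hβ0, hβ1⟩ hxz hx
      by_cases hr : x ∈ range z
      · obtain ⟨k, rfl⟩ := hr
        obtain ⟨β, hβ, hl, hβ0, hβ1, hne⟩ := hzβ k
        have hkn : n ≤ k := not_lt.1 fun hlt => hxz k hlt rfl
        exact ⟨β 1, hx, fun _ => hne, hβ1, β, hU.antitone hkn hβ, hl, hβ0, rfl⟩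
      · exact ⟨β 1, hx, fun h => absurd h hr, hβ1, β, hβ, hl, hβ0, rfl⟩
  classical
  have hhol : W.IsHolonomy α τ (fun x => if x = α 0 then α 0 else h x) := by
    intro U' hU'
    obtain ⟨n, hn⟩ := hU.mem_iff.1 hU'
    have := hh n
    rw [eventually_inf_principal] at this
    filter_upwards [this] with x hx
    by_cases hxα : x = α 0
    · rw [if_pos hxα]
      exact ⟨hτ.1, α, mem_of_mem_nhds hU', hα, hxα.symm, h1⟩
    · rw [if_neg hxα]
      obtain ⟨-, -, h2, β, hβ, h3⟩ := hx hxα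
      exact ⟨h2, β, hn hβ, h3⟩
  have hid := hW α hα h1 τ hτ _ hhol
  have h0 := hh 0
  rw [eventually_inf_principal] at h0
  obtain ⟨n, hn1, hn2⟩ := (hztend.eventually (hid.and h0)).exists
  rw [if_neg (hz0 n)] at hn1
  exact (hn2 (hz0 n)).2.1 ⟨n, rfl⟩ hn1

end Foliation

/-! ### Trivial holonomy and deck transformations. -/

namespace Foliation

variable {d : ℕ} {M : Type u} [TopologicalSpace M] [ChartedSpace (EuclideanSpace ℝ (Fin d)) M]
  {W : Foliation d M} {M' : Type v} [TopologicalSpace M'] {p : M' → M}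

/-- Near a point, the plaques of the lifted foliation are collapsed to the transversal on which
the leafwise coordinate is constant. -/
theorem exists_collapse (hp : IsLocalHomeomorph p) {φ} (hφ : φ ∈ W.charts) {m : M}
    (hm : m ∈ φ.source) {y : M'} (hy : p y = m) :
    ∃ ρ : M' → M', Tendsto ρ (𝓝 y) (𝓝 y) ∧ ∀ᶠ z in 𝓝 y,
      ((φ m).1, (φ (p z)).2) ∈ φ.target ∧ p (ρ z) = φ.symm ((φ m).1, (φ (p z)).2) := by
  subst hy
  obtain ⟨ψ, hyψ, hsub, hψφ, -⟩ := exists_liftChart hp hφ hm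
  have h1 : ContinuousAt (fun z => ((ψ y).1, (ψ z).2)) y :=
    continuousAt_const.prodMk (ψ.continuousAt hyψ).snd
  have h2 : ContinuousAt (fun z => ψ.symm ((ψ y).1, (ψ z).2)) y :=
    ContinuousAt.comp (g := ψ.symm) (ψ.continuousAt_symm (ψ.map_source hyψ)) h1
  refine ⟨fun z => ψ.symm ((ψ y).1, (ψ z).2), ?_, ?_⟩
  · have := h2.tendsto
    rwa [Prod.mk.eta, ψ.left_inv hyψ] at this
  · filter_upwards [h1.eventually (ψ.open_target.mem_nhds (ψ.map_source hyψ))] with z hz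
    have h3 := ψ.map_target hz
    have h4 := hsub h3
    have h5 : φ (p (ψ.symm ((ψ y).1, (ψ z).2))) = ((φ (p y)).1, (φ (p z)).2) := by
      rw [← hψφ, ψ.right_inv hz, hψφ, hψφ]
    rw [← h5]
    exact ⟨φ.map_source h4, (φ.left_inv h4).symm⟩

/-- If the foliation has no holonomy, then a deck transformation that preserves a leaf preserves
all nearby leaves. -/
theorem WithoutHolonomy.eventually_map_mem_liftLeaf [T2Space M] [SecondCountableTopology M]
    (hW : W.WithoutHolonomy) (hp : IsLocalHomeomorph p) {g : M' → M'} (hg : Continuous g)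
    (hpg : p ∘ g = p) {x : M'} (hx : g x ∈ W.liftLeaf p x) :
    ∀ᶠ y in 𝓝 x, g y ∈ W.liftLeaf p y := by
  have hpg' : ∀ y, p (g y) = p y := congrFun hpg
  have := ChartedSpace.locallyCompactSpace (EuclideanSpace ℝ (Fin d)) M
  have := Manifold.metrizableSpace (𝓡 d) M
  let := TopologicalSpace.metrizableSpaceMetric M
  obtain ⟨α, hα, hα0, hα1⟩ := hx
  obtain ⟨φ, hφ, hm⟩ := W.exists_chart (p x)
  let τ : Set M := (fun c => φ.symm ((φ (p x)).1, c)) '' {c | ((φ (p x)).1, c) ∈ φ.target}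
  have hτy : ∀ {y ρ}, ((φ (p x)).1, (φ (p y)).2) ∈ φ.target →
      p ρ = φ.symm ((φ (p x)).1, (φ (p y)).2) →
      p ρ ∈ τ ∧ (φ (p ρ)).2 = (φ (p y)).2 := by
    intro y ρ h1 h2
    rw [h2, φ.right_inv h1]
    exact ⟨⟨_, h1, rfl⟩, rfl⟩
  -- The path from x to g x projects to a closed leaf curve. The constant second half leaves time
  -- for nearby paths to be corrected so as to end on the transversal τ.
  have hcont : Continuous (p ∘ pathConcat α fun _ => g x) :=
    hp.continuous.comp (continuous_pathConcat α.continuous continuous_const hα1)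
  have hleaf : W.IsLeafPath (p ∘ pathConcat α fun _ => g x) := by
    rw [comp_pathConcat]
    exact hα.concat (isLeafPath_const _) (by simp [hα1])
  let A : C(unitInterval, M) := ⟨_, hcont⟩
  have hA0 : A 0 = p x := by
    change p (pathConcat α (fun _ => g x) 0) = p x
    rw [pathConcat_zero, hα0]
  have hA1 : A 1 = p x := by
    change p (pathConcat α (fun _ => g x) 1) = p x
    rw [pathConcat_one, hpg']
  have hτ : W.IsTransversal τ (A 0) := by
    rw [hA0]
    have ho : IsOpen {c | ((φ (p x)).1, c) ∈ φ.target} := φ.open_target.preimage (by fun_prop)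
    refine ⟨⟨(φ (p x)).2, φ.map_source hm, φ.left_inv hm⟩, φ, hφ, _, _, ho, ?_, ?_, rfl⟩
    · exact φ.continuousOn_symm.comp (by fun_prop) fun c hc => hc
    · intro c hc
      exact ⟨φ.map_target hc, by rw [φ.right_inv hc]⟩
  have hex : ∀ U ∈ 𝓝 A, ∀ N ∈ 𝓝 (g x), ∀ᶠ z in 𝓝 x, ∃ β : C(unitInterval, M'),
      W.IsLeafPath (p ∘ β) ∧ (⟨p ∘ β, hp.continuous.comp β.continuous⟩ : C(unitInterval, M)) ∈ U ∧
      β 0 = z ∧ β 1 ∈ N ∧ p (β 1) ∈ τ := by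
    intro U hU N hN
    obtain ⟨ε, hε, hball⟩ := Metric.mem_nhds_iff.1 hU
    obtain ⟨ρ, hρ, hρτ⟩ := exists_collapse hp hφ hm (hpg' x)
    -- The correction κ runs inside the plaque of w to its collapse over τ and stays ε-close to the
    -- constant half of A.
    have hN₁ : ∀ᶠ w in 𝓝 (g x), ∃ κ : unitInterval → M', Continuous κ ∧ W.IsLeafPath (p ∘ κ) ∧
        κ 0 = w ∧ κ 1 ∈ N ∧ p (κ 1) ∈ τ ∧ ∀ s, dist (p (κ s)) (p (g x)) < ε := by
      have h1 := eventually_exists_isLeafPath (W := W) hp hφ (x := g x) (by rwa [hpg'])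
        (hp.continuous.continuousAt.preimage_mem_nhds (Metric.ball_mem_nhds (p (g x)) hε))
      have h2 : Tendsto (fun w => (w, ρ w)) (𝓝 (g x)) (𝓝 (g x, g x)) := by
        rw [nhds_prod_eq]
        exact tendsto_id.prodMk hρ
      filter_upwards [h2.eventually h1, hρτ, hρ hN] with w hw ⟨hw1, hw2⟩ hwN
      obtain ⟨e1, e2⟩ := hτy hw1 hw2
      obtain ⟨κ, hκ, hl, h0, h1, hs⟩ := hw e2.symm
      exact ⟨κ, hκ, hl, h0, by rw [h1]; exact hwN, by rw [h1]; exact e1, hs⟩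
    obtain ⟨N₁, hN₁, hN₁o, hgx⟩ := eventually_nhds_iff.1 hN₁
    have hO : IsOpen {z : unitInterval × M' | dist (p z.2) (p (α z.1)) < ε ∧ (z.1 ≠ 1 ∨ z.2 ∈ N₁)} := by
      have hpc : Continuous fun z : unitInterval × M' => dist (p z.2) (p (α z.1)) :=
        (hp.continuous.comp continuous_snd).dist
          (hp.continuous.comp (α.continuous.comp continuous_fst))
      refine (isOpen_lt hpc continuous_const).inter (IsOpen.union ?_ ?_)
      · exact isOpen_compl_singleton.preimage continuous_fst
      · exact hN₁o.preimage continuous_snd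
    have key := eventually_exists_isLeafPath_near hp α.continuous hα hO fun s => by
      refine ⟨by simpa using hε, ?_⟩
      by_cases hs : s = 1
      · right; simp only [hs, hα1]; exact hgx
      · left; exact hs
    rw [hα0] at key
    filter_upwards [key] with z ⟨β, hβ, hl, hβ0, hβs⟩
    obtain ⟨κ, hκ, hκl, hκ0, hκ1, hκτ, hκs⟩ := hN₁ (β 1) ((hβs 1).2.resolve_left fun h => h rfl)
    refine ⟨⟨pathConcat β κ, continuous_pathConcat hβ hκ hκ0.symm⟩, ?_, hball ?_, ?_, ?_, ?_⟩
    · change W.IsLeafPath (p ∘ pathConcat β κ)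
      rw [comp_pathConcat]
      exact hl.concat hκl (by simp [hκ0])
    · rw [Metric.mem_ball, ContinuousMap.dist_lt_iff hε]
      exact fun s => pathConcat_rel (r := fun y y' => dist (p y) (p y') < ε) (fun s => (hβs s).1)
        hκs s
    · exact (pathConcat_zero _ _).trans hβ0
    · change pathConcat β κ 1 ∈ N
      rwa [pathConcat_one]
    · change p (pathConcat β κ 1) ∈ τ
      rwa [pathConcat_one]
  obtain ⟨U, hU, hloop⟩ := hW.eventually_apply_one_eq (α := A) hleaf (hA1.trans hA0.symm) hτ (by
    intro U hU
    refine nhdsWithin_le_nhds ?_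
    rw [hA0, ← hp.map_nhds_eq x, mem_map]
    filter_upwards [hex U hU univ univ_mem] with z ⟨β, h1, h2, h3, _, h5⟩
    exact ⟨_, h2, h1, congrArg p h3, h5⟩)
  rw [hA0, eventually_nhdsWithin_iff, ← hp.map_nhds_eq x, eventually_map] at hloop
  obtain ⟨e, he, hpe⟩ := hp (g x)
  obtain ⟨e', he', hpe'⟩ := hp x
  have hτfix : ∀ᶠ z in 𝓝 x, p z ∈ τ → g z ∈ W.liftLeaf p z := by
    filter_upwards [hloop, hex U hU e.source (e.open_source.mem_nhds he),
      hg.continuousAt.eventually (e.open_source.mem_nhds he), e'.open_source.mem_nhds he']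
      with z hz ⟨β, h1, h2, h3, h4, h5⟩ hze hze' hzτ
    -- The base point of the transversal is excluded in `hloop`; there z = x, and α itself is the
    -- required path.
    by_cases hpz : p z = p x
    · have : z = x := e'.injOn hze' he' (by rw [← hpe', hpz])
      rw [this]
      exact ⟨α, hα, hα0, hα1⟩
    · have hβ := hz hzτ hpz _ h2 h1 (congrArg p h3) h5
      -- Trivial holonomy gives p (β 1) = p z = p (g z). Both points are close to g x, where p is
      -- injective.
      have hβ1 : β 1 = g z := e.injOn h4 hze (by
        rw [← hpe, hpg']; exact hβ)
      rw [← hβ1, ← h3]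
      exact mem_liftLeaf_of_path β.continuous h1
  obtain ⟨ρ, hρ, hρτ⟩ := exists_collapse hp hφ hm (y := x) rfl
  have h2 : Tendsto (fun w => (w, ρ w)) (𝓝 x) (𝓝 (x, x)) := by
    rw [nhds_prod_eq]
    exact tendsto_id.prodMk hρ
  -- A general z shares its leaf with its collapse ρ z over τ, and g carries that common leaf to a
  -- leaf.
  filter_upwards [hρ.eventually hτfix, hρτ, h2.eventually (eventually_mem_liftLeaf hp hφ hm)]
    with z hz ⟨h3, h4⟩ hz'
  obtain ⟨e1, e2⟩ := hτy h3 h4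
  have h5 := hz' e2.symm
  exact liftLeaf_trans (liftLeaf_trans h5 (hz e1)) (liftLeaf_symm (map_mem_liftLeaf hg hpg h5))

end Foliation

namespace Foliation

variable {d : ℕ} {M : Type u} [TopologicalSpace M] [ChartedSpace (EuclideanSpace ℝ (Fin d)) M]
  {M' : Type v} [TopologicalSpace M'] {p : M' → M}

/-! ### Local product structure on the covering space -/

section LocalProduct

variable [IsManifold (𝓡 d) ∞ M] {W W' : Foliation d M}
  {E E' F : (x : M) → Submodule ℝ (TangentSpace (𝓡 d) x)}

/-- The last conclusion, that r and y.2 share a plaque and not just a leaf, is what later shows that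
lifted center leaves do not return close to themselves in another plaque. -/
theorem IsTangentTo.eventually_exists_mem_liftLeaf_inter (hW : W.IsTangentTo E)
    (hW' : W'.IsTangentTo E') (hp : IsLocalHomeomorph p) {ι κ : Type*} [Fintype ι] [Fintype κ]
    {x : M'} {e : M → ι → EuclideanSpace ℝ (Fin d)} {e' : M → κ → EuclideanSpace ℝ (Fin d)}
    (he : IsFrameAt E (p x) e) (he' : IsFrameAt E' (p x) e') (hc : IsCompl (E (p x)) (E' (p x)))
    {ψ} (hψ : ψ ∈ W'.charts) (hm' : p x ∈ ψ.source) {N : Set M'} (hN : N ∈ 𝓝 x) :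
    ∀ᶠ y in 𝓝 (x, x), ∃ r ∈ N, r ∈ W.liftLeaf p y.1 ∧ r ∈ W'.liftLeaf p y.2 ∧
      (ψ (p r)).2 = (ψ (p y.2)).2 := by
  obtain ⟨φ, hφ, hm⟩ := W.exists_chart (p x)
  have h1 := (eventually_mem_liftLeaf (W := W) hp hφ hm)
  have h2 := (eventually_mem_liftLeaf (W := W') hp hψ hm')
  rw [nhds_prod_eq] at h1 h2
  obtain ⟨P, hP, Q, hQ, hPQ⟩ := eventually_prod_iff.1 h1
  obtain ⟨P', hP', Q', hQ', hPQ'⟩ := eventually_prod_iff.1 h2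
  have hN' : p '' (N ∩ ({y | Q y} ∩ {y | Q' y})) ∈ 𝓝 (p x) := by
    rw [← hp.map_nhds_eq x]
    exact image_mem_map (inter_mem hN (inter_mem hQ hQ'))
  have h3 := hW.eventually_exists_inter hW' he he' hc hφ hm hψ hm' hN'
  have ht : Tendsto (Prod.map p p) (𝓝 (x, x)) (𝓝 (p x, p x)) := by
    rw [nhds_prod_eq, nhds_prod_eq]
    exact hp.continuous.continuousAt.tendsto.prodMap hp.continuous.continuousAt.tendsto
  filter_upwards [ht.eventually h3, hP.prod_nhds hP'] with y ⟨_, ⟨r, ⟨hrN, hrQ, hrQ'⟩, rfl⟩, e1, e2⟩ ⟨hy1, hy2⟩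
  exact ⟨r, hrN, hPQ hy1 hrQ e1.symm, hPQ' hy2 hrQ' e2.symm, e2⟩

theorem IsTangentTo.eventually_exists_mem_liftLeaf_inter_of_le (hW : W.IsTangentTo E)
    (hW' : W'.IsTangentTo E') (hp : IsLocalHomeomorph p) {ι : Type*} [Fintype ι]
    {x : M'} {e : M → ι → EuclideanSpace ℝ (Fin d)} (he : IsFrameAt E (p x) e)
    (hF : F (p x) ≤ E' (p x)) (hc : IsCompl (E (p x)) (F (p x))) :
    ∀ᶠ y in 𝓝 x, ∃ r, r ∈ W.liftLeaf p y ∧ r ∈ W'.liftLeaf p x := by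
  obtain ⟨φ, hφ, hm⟩ := W.exists_chart (p x)
  obtain ⟨ψ, hψ, hm'⟩ := W'.exists_chart (p x)
  have h1 := (eventually_mem_liftLeaf (W := W) hp hφ hm)
  have h2 := (eventually_mem_liftLeaf (W := W') hp hψ hm')
  rw [nhds_prod_eq] at h1 h2
  obtain ⟨P, hP, Q, hQ, hPQ⟩ := eventually_prod_iff.1 h1
  obtain ⟨P', hP', Q', hQ', hPQ'⟩ := eventually_prod_iff.1 h2
  have hN' : p '' ({y | Q y} ∩ {y | Q' y}) ∈ 𝓝 (p x) := by
    rw [← hp.map_nhds_eq x]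
    exact image_mem_map (inter_mem hQ hQ')
  have h3 := hW.eventually_exists_inter_of_le hW' he hF hc hφ hm hψ hm' hN'
  filter_upwards [hp.continuous.continuousAt.eventually h3, hP] with y ⟨_, ⟨r, ⟨hrQ, hrQ'⟩, rfl⟩, e1, e2⟩ hy
  exact ⟨r, hPQ hy hrQ e1.symm, hPQ' hP'.self_of_nhds hrQ' e2.symm⟩

end LocalProduct

/-- The intersection point of two leaves depends continuously on the leaves. -/
theorem continuous_of_mem_liftLeaf_inter {W W' : Foliation d M} (hp : IsLocalHomeomorph p)
    (hloc : ∀ x : M', ∀ N ∈ 𝓝 x, ∀ᶠ y in 𝓝 (x, x),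
      ∃ r ∈ N, r ∈ W.liftLeaf p y.1 ∧ r ∈ W'.liftLeaf p y.2)
    {I : M' × M' → M'} (hI : ∀ z, I z ∈ W.liftLeaf p z.1 ∧ I z ∈ W'.liftLeaf p z.2)
    (huniq : ∀ x y r r', r ∈ W.liftLeaf p x → r ∈ W'.liftLeaf p y → r' ∈ W.liftLeaf p x →
      r' ∈ W'.liftLeaf p y → r = r') : Continuous I := by
  rw [continuous_iff_continuousAt]
  rintro ⟨x, y⟩ N hN
  have h := hloc _ N hN
  rw [nhds_prod_eq] at h
  obtain ⟨P, hP, Q, hQ, hPQ⟩ := eventually_prod_iff.1 h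
  -- Leaves near those of x and y pass close to I (x, y), hence intersect near it by local product
  -- structure. By uniqueness that intersection is the value of I.
  have h1 := (eventually_exists_mem_liftLeaf hp (hI (x, y)).1 hP).prod_nhds
    (eventually_exists_mem_liftLeaf hp (hI (x, y)).2 hQ)
  change ∀ᶠ z in 𝓝 (x, y), I z ∈ N
  filter_upwards [h1] with z ⟨⟨w, hw, hwz⟩, w', hw', hwz'⟩
  obtain ⟨r, hr, hrw, hrw'⟩ := hPQ hw hw'
  rw [huniq z.1 z.2 (I z) r (hI z).1 (hI z).2 (liftLeaf_trans hwz hrw)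
    (liftLeaf_trans hwz' hrw')]
  exact hr

/-! ### Leaves and their lifts -/

theorem map_mem_leaf {W : Foliation d M} {x y : M'} (h : y ∈ W.liftLeaf p x) :
    p y ∈ W.leaf (p x) := by
  obtain ⟨γ, hγ, rfl, rfl⟩ := h
  exact ⟨p ∘ γ, hγ, rfl, rfl⟩

theorem exists_mem_liftLeaf_of_mem_leaf {W : Foliation d M} (hp : IsCoveringMap p) {x : M'} {q : M}
    (h : q ∈ W.leaf (p x)) : ∃ y ∈ W.liftLeaf p x, p y = q := by
  obtain ⟨γ, hγ, h0, rfl⟩ := h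
  obtain ⟨Γ, hΓ, hΓ0⟩ := hp.exists_path_lifts ⟨γ, hγ.continuous⟩ x h0
  exact ⟨Γ 1, ⟨Γ, by rw [hΓ]; exact hγ, hΓ0, rfl⟩, congrFun hΓ 1⟩

/-- A map between lifted leaves that is compatible with the covering descends to leaves. -/
theorem exists_continuous_leaf_map {W : Foliation d M} (hp : IsCoveringMap p)
    (hemb : ∀ x : M', ∀ φ ∈ W.charts, p x ∈ φ.source →
      ∀ᶠ y in 𝓝 x, y ∈ W.liftLeaf p x → (φ (p y)).2 = (φ (p x)).2)
    {x z : M'} {ρ : M' → M'} (hρ : Continuous ρ)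
    (hmaps : ∀ y ∈ W.liftLeaf p x, ρ y ∈ W.liftLeaf p z)
    (hcomp : ∀ y ∈ W.liftLeaf p x, ∀ y' ∈ W.liftLeaf p x, p y = p y' → p (ρ y) = p (ρ y')) :
    ∃ f : W.Leaf (p x) → W.Leaf (p z), Continuous f ∧
      ∀ y (hy : y ∈ W.liftLeaf p x), f ⟨p y, map_mem_leaf hy⟩ = ⟨p (ρ y), map_mem_leaf (hmaps y hy)⟩ := by
  -- The lifts are chosen without any continuity; `hcomp` makes the result independent of the
  -- choice, so that a local inverse of p can be used for continuity.
  choose s hs hps using fun q : W.Leaf (p x) => exists_mem_liftLeaf_of_mem_leaf hp q.2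
  let f : W.Leaf (p x) → W.Leaf (p z) := fun q => ⟨p (ρ (s q)), map_mem_leaf (hmaps _ (hs q))⟩
  have hf : ∀ y (hy : y ∈ W.liftLeaf p x),
      f ⟨p y, map_mem_leaf hy⟩ = ⟨p (ρ y), map_mem_leaf (hmaps y hy)⟩ := fun y hy =>
    Subtype.ext (hcomp _ (hs _) _ hy (hps _))
  refine ⟨f, ?_, hf⟩
  have hl := hp.isLocalHomeomorph
  refine (continuous_induced_rng (f := Subtype.val) (t₂ := W.leafTopology)).2 ?_
  refine (@continuous_iff_continuousAt _ _ _ W.leafTopology _).2 fun q => ?_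
  obtain ⟨y, hy, hyq⟩ := exists_mem_liftLeaf_of_mem_leaf hp q.2
  have hq : q = ⟨p y, map_mem_leaf hy⟩ := Subtype.ext hyq.symm
  subst hq
  obtain ⟨φ, hφ, hyφ⟩ := W.exists_chart (p y)
  obtain ⟨ψ, hψ, hyψ⟩ := W.exists_chart (p (ρ y))
  obtain ⟨e, he, hpe⟩ := hl y
  have hpy : e.symm (p y) = y := by rw [hpe]; exact e.left_inv he
  have hes : Tendsto e.symm (𝓝 (p y)) (𝓝 y) := by
    have := (e.continuousAt_symm (e.map_source he)).tendsto
    rwa [e.left_inv he, ← hpe] at this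
  have hpes : ∀ᶠ r in 𝓝 (p y), p (e.symm r) = r := by
    filter_upwards [e.open_target.mem_nhds (by rw [hpe]; exact e.map_source he)] with r hr
    rw [hpe]; exact e.right_inv hr
  have hval : Tendsto (fun q : W.Leaf (p x) => q.1) (𝓝 ⟨p y, map_mem_leaf hy⟩)
      (𝓝[{r | (φ r).2 = (φ (p y)).2}] (p y)) := by
    rw [← W.nhds_leafTopology hφ hyφ]
    exact @Continuous.tendsto _ _ _ W.leafTopology _ continuous_induced_dom _
  have hmem : ∀ᶠ r in 𝓝[{r | (φ r).2 = (φ (p y)).2}] (p y), e.symm r ∈ W.liftLeaf p y := by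
    have h1 := eventually_mem_liftLeaf (W := W) hl hφ hyφ
    have h2 : Tendsto (fun w : M' => (y, w)) (𝓝 y) (𝓝 (y, y)) :=
      (Continuous.tendsto (by fun_prop) y : Tendsto (fun w : M' => (y, w)) (𝓝 y) (𝓝 (y, y)))
    filter_upwards [nhdsWithin_le_nhds (hes.eventually (h2.eventually h1)),
      nhdsWithin_le_nhds hpes, self_mem_nhdsWithin] with r h3 h4 h5
    refine h3 ?_
    simp only [h4]
    exact h5.symm
  have hgoal : Tendsto (fun r => p (ρ (e.symm r))) (𝓝[{r | (φ r).2 = (φ (p y)).2}] (p y))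
      (@nhds M W.leafTopology (p (ρ y))) := by
    rw [W.nhds_leafTopology hψ hyψ]
    have hρe : Tendsto (fun r => ρ (e.symm r)) (𝓝 (p y)) (𝓝 (ρ y)) :=
      (hρ.tendsto y).comp hes
    refine tendsto_nhdsWithin_iff.2 ⟨((hl.continuous.tendsto _).comp hρe).mono_left
      nhdsWithin_le_nhds, ?_⟩
    -- The image is close to ρ y and in the same lifted leaf, so `hemb` puts it in the same plaque,
    -- which upgrades continuity to the leaf topology.
    filter_upwards [nhdsWithin_le_nhds (hρe.eventually (hemb (ρ y) ψ hψ hyψ)), hmem] with r h1 h2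
    exact h1 (liftLeaf_trans (liftLeaf_symm (hmaps y hy)) (hmaps _ (liftLeaf_trans hy h2)))
  have hfy : (f ⟨p y, map_mem_leaf hy⟩).1 = p (ρ y) := by rw [hf y hy]
  have key := hgoal.comp hval
  rw [← hfy] at key
  refine Tendsto.congr' ?_ key
  filter_upwards [hval.eventually hmem, hval.eventually (nhdsWithin_le_nhds hpes)] with q h1 h2
  have hq : q = ⟨p (e.symm q.1), map_mem_leaf (liftLeaf_trans hy h1)⟩ := Subtype.ext h2.symm
  have := hf (e.symm q.1) (liftLeaf_trans hy h1)
  rw [← hq] at this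
  exact (congrArg Subtype.val this).symm

/-- Maps between lifted leaves that are inverse to each other and compatible with the covering
descend to homeomorphisms. -/
theorem nonempty_leaf_homeomorph {W : Foliation d M} (hp : IsCoveringMap p)
    (hemb : ∀ x : M', ∀ φ ∈ W.charts, p x ∈ φ.source →
      ∀ᶠ y in 𝓝 x, y ∈ W.liftLeaf p x → (φ (p y)).2 = (φ (p x)).2)
    {x z : M'} {ρ ρ' : M' → M'} (hρ : Continuous ρ) (hρ' : Continuous ρ')
    (hmaps : ∀ y ∈ W.liftLeaf p x, ρ y ∈ W.liftLeaf p z)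
    (hmaps' : ∀ y ∈ W.liftLeaf p z, ρ' y ∈ W.liftLeaf p x)
    (hcomp : ∀ y ∈ W.liftLeaf p x, ∀ y' ∈ W.liftLeaf p x, p y = p y' → p (ρ y) = p (ρ y'))
    (hcomp' : ∀ y ∈ W.liftLeaf p z, ∀ y' ∈ W.liftLeaf p z, p y = p y' → p (ρ' y) = p (ρ' y'))
    (hinv : ∀ y ∈ W.liftLeaf p x, ρ' (ρ y) = y) (hinv' : ∀ y ∈ W.liftLeaf p z, ρ (ρ' y) = y) :
    Nonempty (W.Leaf (p x) ≃ₜ W.Leaf (p z)) := by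
  obtain ⟨f, hf, hfe⟩ := exists_continuous_leaf_map hp hemb hρ hmaps hcomp
  obtain ⟨f', hf', hfe'⟩ := exists_continuous_leaf_map hp hemb hρ' hmaps' hcomp'
  refine ⟨⟨⟨f, f', fun q => ?_, fun q => ?_⟩, hf, hf'⟩⟩
  · obtain ⟨y, hy, hyq⟩ := exists_mem_liftLeaf_of_mem_leaf hp q.2
    have hq : q = ⟨p y, map_mem_leaf hy⟩ := Subtype.ext hyq.symm
    rw [hq, hfe y hy, hfe' _ (hmaps y hy)]
    exact Subtype.ext (congrArg p (hinv y hy))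
  · obtain ⟨y, hy, hyq⟩ := exists_mem_liftLeaf_of_mem_leaf hp q.2
    have hq : q = ⟨p y, map_mem_leaf hy⟩ := Subtype.ext hyq.symm
    rw [hq, hfe' y hy, hfe _ (hmaps' y hy)]
    exact Subtype.ext (congrArg p (hinv' y hy))

/-- Sliding along the leaves of a foliation `Wa` with product structure with respect to `Wb`
identifies leaves of `W`. -/
theorem nonempty_leaf_homeomorph_of_product {W Wa Wac Wb : Foliation d M} (hp : IsCoveringMap p)
    (hemb : ∀ x : M', ∀ φ ∈ W.charts, p x ∈ φ.source →
      ∀ᶠ y in 𝓝 x, y ∈ W.liftLeaf p x → (φ (p y)).2 = (φ (p x)).2)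
    (hWac : ∀ x : M', W.liftLeaf p x ⊆ Wac.liftLeaf p x)
    (hWb : ∀ x : M', W.liftLeaf p x ⊆ Wb.liftLeaf p x)
    (ha : ∀ x : M', Wa.liftLeaf p x ⊆ Wac.liftLeaf p x)
    (hinter : ∀ x y : M', y ∈ Wac.liftLeaf p x → y ∈ Wb.liftLeaf p x → y ∈ W.liftLeaf p x)
    {I : M' × M' → M'} (hIc : Continuous I)
    (hI : ∀ z, I z ∈ Wa.liftLeaf p z.1 ∧ I z ∈ Wb.liftLeaf p z.2)
    (huniq : ∀ x y r r', r ∈ Wa.liftLeaf p x → r ∈ Wb.liftLeaf p y → r' ∈ Wa.liftLeaf p x →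
      r' ∈ Wb.liftLeaf p y → r = r')
    (hdeck : ∀ y y' : M', p y = p y' → ∃ g : M' → M', Continuous g ∧ p ∘ g = p ∧ g y = y')
    (hfix : ∀ g : M' → M', Continuous g → p ∘ g = p → ∀ y, g y ∈ W.liftLeaf p y →
      ∀ z, g z ∈ W.liftLeaf p z)
    {x z : M'} (hxz : x ∈ Wa.liftLeaf p z) : Nonempty (W.Leaf (p x) ≃ₜ W.Leaf (p z)) := by
  have hmaps : ∀ {x z : M'}, x ∈ Wa.liftLeaf p z → ∀ y ∈ W.liftLeaf p x,
      I (y, z) ∈ W.liftLeaf p z := by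
    intro x z hxz y hy
    refine hinter _ _ ?_ (hI (y, z)).2
    exact liftLeaf_trans (ha _ hxz) (liftLeaf_trans (hWac _ hy) (ha _ (hI (y, z)).1))
  have hcomp : ∀ {x : M'} (z : M'), ∀ y ∈ W.liftLeaf p x, ∀ y' ∈ W.liftLeaf p x, p y = p y' →
      p (I (y, z)) = p (I (y', z)) := by
    intro x z y hy y' hy' hyy'
    obtain ⟨g, hg, hpg, rfl⟩ := hdeck y y' hyy'
    have hgz := hfix g hg hpg y (liftLeaf_trans (liftLeaf_symm hy) hy') z
    -- Since g preserves the leaf of y, it preserves that of z. Hence g (I (y, z)) lies in the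
    -- `Wa`-leaf of g y and the `Wb`-leaf of z, and must be I (g y, z).
    rw [huniq (g y) z (I (g y, z)) (g (I (y, z))) (hI (g y, z)).1 (hI (g y, z)).2
      (map_mem_liftLeaf hg hpg (hI (y, z)).1)
      (liftLeaf_trans (hWb _ hgz) (map_mem_liftLeaf hg hpg (hI (y, z)).2))]
    exact (congrFun hpg _).symm
  have hinv : ∀ {x : M'} (z : M'), ∀ y ∈ W.liftLeaf p x, I (I (y, z), x) = y := fun {x} z y hy =>
    huniq _ _ _ _ (hI (I (y, z), x)).1 (hI (I (y, z), x)).2 (liftLeaf_symm (hI (y, z)).1) (hWb _ hy)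
  exact nonempty_leaf_homeomorph hp hemb (ρ := fun y => I (y, z)) (ρ' := fun y => I (y, x))
    (by fun_prop) (by fun_prop) (hmaps hxz) (hmaps (liftLeaf_symm hxz)) (hcomp z) (hcomp x)
    (hinv z) (hinv x)

/-! ### Deck transformations -/

theorem _root_.IsLocalHomeomorph.locallyPathConnectedSpace {X Y : Type*} [TopologicalSpace X]
    [TopologicalSpace Y] [LocallyPathConnectedSpace Y] {q : X → Y} (hq : IsLocalHomeomorph q) :
    LocallyPathConnectedSpace X := by
  let : ChartedSpace Y X :=
    { atlas := univ
      chartAt := fun x => (hq x).choose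
      mem_chart_source := fun x => (hq x).choose_spec.1
      chart_mem_atlas := fun _ => mem_univ _ }
  exact ChartedSpace.locallyPathConnectedSpace Y X

theorem _root_.IsCoveringMap.exists_deck {X Y : Type*} [TopologicalSpace X] [TopologicalSpace Y]
    [LocallyPathConnectedSpace Y] [SimplyConnectedSpace X] {q : X → Y} (hq : IsCoveringMap q)
    {x x' : X} (h : q x = q x') : ∃ g : X → X, Continuous g ∧ q ∘ g = q ∧ g x = x' := by
  have := hq.isLocalHomeomorph.locallyPathConnectedSpace
  obtain ⟨g, ⟨h1, h2⟩, -⟩ := hq.existsUnique_continuousMap_lifts ⟨q, hq.continuous⟩ x x' h.symm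
  exact ⟨g, g.continuous, h2, h1⟩

end Foliation

/-! ### Consequences of Global Product Structure for the lifted leaves. -/

section GlobalProduct

variable {d : ℕ} {M : Type u} [TopologicalSpace M] [ChartedSpace (EuclideanSpace ℝ (Fin d)) M]
  {M' : Type v} [TopologicalSpace M'] {p : M' → M} {Ws Wc Wu Wcs Wcu : Foliation d M}

open Foliation

namespace HasGlobalProductStructure

/-- If nearby center-unstable leaves meet every center-stable leaf, then stable leaves are
contained in center-stable leaves. -/
theorem s_subset_cs (h : HasGlobalProductStructure p Ws Wc Wu Wcs Wcu)
    (hc_cs : Wc.IsSubfoliation Wcs) (hc_cu : Wc.IsSubfoliation Wcu)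
    (hloc : ∀ x : M', ∀ᶠ y in 𝓝 x, ∃ r, r ∈ Wcu.liftLeaf p y ∧ r ∈ Wcs.liftLeaf p x) (x : M') :
    Ws.liftLeaf p x ⊆ Wcs.liftLeaf p x := by
  rintro _ ⟨γ, hγ, rfl, rfl⟩
  have hs : ∀ s t, γ t ∈ Ws.liftLeaf p (γ s) := by
    have h0 : ∀ t, γ t ∈ Ws.liftLeaf p (γ 0) := by
      intro t
      have hθ : Continuous fun s : unitInterval => t * s := by fun_prop
      have := mem_liftLeaf_of_path (W := Ws) (p := p) (γ := γ ∘ fun s => t * s)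
        (γ.continuous.comp hθ) (hγ.comp hθ)
      simpa using this
    exact fun s t => liftLeaf_trans (liftLeaf_symm (h0 s)) (h0 t)
  -- Lying in the same center-stable leaf is an equivalence relation, so by connectedness of the
  -- interval only nearby parameters need comparison.
  refine isPreconnected_univ.induction₂ (fun s t => γ t ∈ Wcs.liftLeaf p (γ s)) ?_
    (fun _ _ _ _ _ _ h h' => liftLeaf_trans h h') (fun _ _ _ _ h => liftLeaf_symm h)
    (mem_univ 0) (mem_univ 1)
  intro s _
  refine nhdsWithin_le_nhds ?_
  filter_upwards [γ.continuous.continuousAt.eventually (hloc (γ s))] with t ⟨r, hr, hr'⟩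
  -- The center leaf of r meets W^s(γ s) at v. Both v and γ t lie in W^s(γ s) ∩ W^cu(γ t), so they
  -- agree, and v lies in W^cs(γ s) through r.
  obtain ⟨v, ⟨hv1, hv2⟩, -⟩ := h.c_s r (γ s) hr'
  have hv : v = γ t := (h.s_cu (γ s) (γ t)).unique
    ⟨hv2, liftLeaf_trans hr (liftLeaf_subset_of_isSubfoliation hc_cu _ hv1)⟩
    ⟨hs s t, mem_liftLeaf_self _⟩
  rw [← hv]
  exact liftLeaf_trans hr' (liftLeaf_subset_of_isSubfoliation hc_cs _ hv1)

/-- Take v in W^s(w) ∩ W^cu(x) and t in W^c(v) ∩ W^u(x). Then t and w both lie in W^u(x) ∩ W^cs(w),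
so w = t lies in W^cu(x). The inclusion of stable leaves already obtained replaces a local argument.
-/
theorem u_subset_cu (h : HasGlobalProductStructure p Ws Wc Wu Wcs Wcu)
    (hc_cs : Wc.IsSubfoliation Wcs) (hc_cu : Wc.IsSubfoliation Wcu)
    (hs_cs : ∀ x, Ws.liftLeaf p x ⊆ Wcs.liftLeaf p x) (x : M') :
    Wu.liftLeaf p x ⊆ Wcu.liftLeaf p x := by
  intro w hw
  obtain ⟨v, ⟨hv1, hv2⟩, -⟩ := h.s_cu w x
  obtain ⟨t, ⟨ht1, ht2⟩, -⟩ := h.c_u v x hv2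
  have ht : t = w := (h.u_cs x w).unique
    ⟨ht2, liftLeaf_trans (hs_cs _ hv1) (liftLeaf_subset_of_isSubfoliation hc_cs _ ht1)⟩
    ⟨hw, mem_liftLeaf_self _⟩
  rw [← ht]
  exact liftLeaf_trans hv2 (liftLeaf_subset_of_isSubfoliation hc_cu _ ht1)

/-- The center leaf of y meets W^s(x) in a point that also lies in W^cu(x). Since x is the only
point of W^s(x) ∩ W^cu(x), the center leaf of y passes through x. -/
theorem mem_c (h : HasGlobalProductStructure p Ws Wc Wu Wcs Wcu)
    (hc_cu : Wc.IsSubfoliation Wcu) (x y : M') (hcs : y ∈ Wcs.liftLeaf p x)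
    (hcu : y ∈ Wcu.liftLeaf p x) : y ∈ Wc.liftLeaf p x := by
  obtain ⟨z, ⟨hz1, hz2⟩, -⟩ := h.c_s y x hcs
  have hz : z = x := (h.s_cu x x).unique
    ⟨hz2, liftLeaf_trans hcu (liftLeaf_subset_of_isSubfoliation hc_cu _ hz1)⟩
    ⟨mem_liftLeaf_self _, mem_liftLeaf_self _⟩
  rw [hz] at hz1
  exact liftLeaf_symm hz1

end HasGlobalProductStructure

end GlobalProduct

/-! ### Linear algebra of the splitting and the conclusion. -/

section Final

variable {d : ℕ} {M : Type u} [TopologicalSpace M]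
  [ChartedSpace (EuclideanSpace ℝ (Fin d)) M] [IsManifold (𝓡 d) ∞ M]
  [RiemannianBundle (fun x : M => TangentSpace (𝓡 d) x)]

theorem IsPartiallyHyperbolic.isCompl_cu_s {f : M → M}
    {Es Ec Eu : (x : M) → Submodule ℝ (TangentSpace (𝓡 d) x)}
    (hf : IsPartiallyHyperbolic f Es Ec Eu) (x : M) : IsCompl (Ec x ⊔ Eu x) (Es x) := by
  have h1 := hf.isCompl_sc_u x
  have h2 : Disjoint (Es x) (Ec x ⊔ Eu x) := (hf.disjoint_s_c x).disjoint_sup_right_of_disjoint_sup_left h1.1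
  refine ⟨h2.symm, codisjoint_iff.2 ?_⟩
  rw [sup_comm, ← sup_assoc, h1.sup_eq_top]

theorem IsPartiallyHyperbolic.isCompl_c_su {f : M → M}
    {Es Ec Eu : (x : M) → Submodule ℝ (TangentSpace (𝓡 d) x)}
    (hf : IsPartiallyHyperbolic f Es Ec Eu) (x : M) : IsCompl (Ec x) (Es x ⊔ Eu x) := by
  have h1 := hf.isCompl_sc_u x
  have h2 : Disjoint (Ec x) (Es x ⊔ Eu x) :=
    (hf.disjoint_s_c x).symm.disjoint_sup_right_of_disjoint_sup_left (by rw [sup_comm]; exact h1.1)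
  refine ⟨h2, codisjoint_iff.2 ?_⟩
  rw [← sup_assoc, sup_comm (Ec x), h1.sup_eq_top]

/-- By the modular law the first two spaces meet in `Es`. This supplies the condition on F = `Es` ⊔
`Eu` in `IsTangentTo.eventually_snd_eq_of_snd_eq`. -/
theorem IsPartiallyHyperbolic.su_inf_cs_inf_cu {f : M → M}
    {Es Ec Eu : (x : M) → Submodule ℝ (TangentSpace (𝓡 d) x)}
    (hf : IsPartiallyHyperbolic f Es Ec Eu) (x : M) :
    (Es x ⊔ Eu x) ⊓ (Ec x ⊔ Es x) ⊓ (Ec x ⊔ Eu x) = ⊥ := by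
  have h1 : (Es x ⊔ Eu x) ⊓ (Ec x ⊔ Es x) = Es x := by
    rw [sup_comm (Ec x), sup_inf_assoc_of_le _ le_sup_left, inf_comm,
      (hf.isCompl_sc_u x).inf_eq_bot, sup_bot_eq]
  rw [h1, inf_comm, (hf.isCompl_cu_s x).inf_eq_bot]

end Final

theorem mainTheorem4 {d : ℕ} {M : Type u} [TopologicalSpace M]
    [ChartedSpace (EuclideanSpace ℝ (Fin d)) M] [IsManifold (𝓡 d) ∞ M]
    [T2Space M] [SecondCountableTopology M] [ConnectedSpace M]
    [RiemannianBundle (fun x : M => TangentSpace (𝓡 d) x)]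
    [IsContMDiffRiemannianBundle (𝓡 d) ∞ (EuclideanSpace ℝ (Fin d))
      (fun x : M => TangentSpace (𝓡 d) x)]
    (f : M ≃ₘ^1⟮𝓡 d, 𝓡 d⟯ M)
    (Es Ec Eu : (x : M) → Submodule ℝ (TangentSpace (𝓡 d) x))
    (hf : IsPartiallyHyperbolic f Es Ec Eu)
    (Ws Wc Wu Wcs Wcu : Foliation d M)
    (hWs : Ws.IsTangentTo Es) (hWc : Wc.IsTangentTo Ec) (hWu : Wu.IsTangentTo Eu)
    (hWcs : Wcs.IsTangentTo (fun x => Ec x ⊔ Es x))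
    (hWcu : Wcu.IsTangentTo (fun x => Ec x ⊔ Eu x))
    (hc_cs : Wc.IsSubfoliation Wcs) (hc_cu : Wc.IsSubfoliation Wcu)
    {M' : Type v} [TopologicalSpace M'] [SimplyConnectedSpace M']
    (p : M' → M) (hp : IsCoveringMap p)
    (hgps : HasGlobalProductStructure p Ws Wc Wu Wcs Wcu)
    (hholo : Wc.WithoutHolonomy) :
    ∀ x y : M, Nonempty (Wc.Leaf x ≃ₜ Wc.Leaf y) := by
  have hl := hp.isLocalHomeomorph
  have := ChartedSpace.locallyPathConnectedSpace (EuclideanSpace ℝ (Fin d)) M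
  have : PathConnectedSpace M := PathConnectedSpace.of_locallyPathConnectedSpace
  have : T2Space M' := by
    refine ⟨fun a b hab => ?_⟩
    by_cases hpab : p a = p b
    · exact hp.isSeparatedMap a b hpab hab
    · obtain ⟨U, V, hU, hV, ha, hb, hUV⟩ := t2_separation hpab
      exact ⟨p ⁻¹' U, p ⁻¹' V, hU.preimage hp.continuous, hV.preimage hp.continuous, ha, hb,
        hUV.preimage p⟩
  have hsurj : Function.Surjective p := by
    intro y
    obtain ⟨x₀⟩ : Nonempty M' := inferInstance
    obtain ⟨γ⟩ := PathConnectedSpace.joined (p x₀) y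
    obtain ⟨Γ, hΓ, -⟩ := hp.exists_path_lifts γ.toContinuousMap x₀ γ.source
    exact ⟨Γ 1, (congrFun hΓ 1).trans γ.target⟩
  have hframe_cu : ∀ m : M, ∃ (k : ℕ) (l : ℕ) (e : M → Fin k ⊕ Fin l → EuclideanSpace ℝ (Fin d)),
      IsFrameAt (fun x => Ec x ⊔ Eu x) m e := by
    intro m
    obtain ⟨k, e, he⟩ := hf.continuous_c.exists_isFrameAt m
    obtain ⟨l, e', he'⟩ := hf.continuous_u.exists_isFrameAt m
    exact ⟨k, l, _, he.sup he' ((hf.isCompl_sc_u m).1.mono_left le_sup_right)⟩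
  have hframe_cs : ∀ m : M, ∃ (k : ℕ) (l : ℕ) (e : M → Fin k ⊕ Fin l → EuclideanSpace ℝ (Fin d)),
      IsFrameAt (fun x => Ec x ⊔ Es x) m e := by
    intro m
    obtain ⟨k, e, he⟩ := hf.continuous_c.exists_isFrameAt m
    obtain ⟨l, e', he'⟩ := hf.continuous_s.exists_isFrameAt m
    exact ⟨k, l, _, he.sup he' (hf.disjoint_s_c m).symm⟩
  have hloc_us : ∀ x : M', ∀ ψ ∈ Wcs.charts, p x ∈ ψ.source → ∀ N ∈ 𝓝 x, ∀ᶠ y in 𝓝 (x, x),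
      ∃ r ∈ N, r ∈ Wu.liftLeaf p y.1 ∧ r ∈ Wcs.liftLeaf p y.2 ∧
        (ψ (p r)).2 = (ψ (p y.2)).2 := by
    intro x ψ hψ hx N hN
    obtain ⟨k, e, he⟩ := hf.continuous_u.exists_isFrameAt (p x)
    obtain ⟨k', l', e', he'⟩ := hframe_cs (p x)
    refine hWu.eventually_exists_mem_liftLeaf_inter hWcs hl he he' ?_ hψ hx hN
    rw [sup_comm]
    exact (hf.isCompl_sc_u _).symm
  have hloc_su : ∀ x : M', ∀ ψ ∈ Wcu.charts, p x ∈ ψ.source → ∀ N ∈ 𝓝 x, ∀ᶠ y in 𝓝 (x, x),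
      ∃ r ∈ N, r ∈ Ws.liftLeaf p y.1 ∧ r ∈ Wcu.liftLeaf p y.2 ∧
        (ψ (p r)).2 = (ψ (p y.2)).2 := by
    intro x ψ hψ hx N hN
    obtain ⟨k, e, he⟩ := hf.continuous_s.exists_isFrameAt (p x)
    obtain ⟨k', l', e', he'⟩ := hframe_cu (p x)
    exact hWs.eventually_exists_mem_liftLeaf_inter hWcu hl he he' (hf.isCompl_cu_s _).symm hψ hx hN
  have hs_cs := hgps.s_subset_cs hc_cs hc_cu fun x => by
    obtain ⟨k, l, e, he⟩ := hframe_cu (p x)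
    exact hWcu.eventually_exists_mem_liftLeaf_inter_of_le hWcs hl he le_sup_right
      (hf.isCompl_cu_s _)
  have hu_cu := hgps.u_subset_cu hc_cs hc_cu hs_cs
  have hc := hgps.mem_c hc_cu
  have hsub_cs : ∀ x : M', Wc.liftLeaf p x ⊆ Wcs.liftLeaf p x :=
    Foliation.liftLeaf_subset_of_isSubfoliation hc_cs
  have hsub_cu : ∀ x : M', Wc.liftLeaf p x ⊆ Wcu.liftLeaf p x :=
    Foliation.liftLeaf_subset_of_isSubfoliation hc_cu
  have huniq_u : ∀ x y r r', r ∈ Wu.liftLeaf p x → r ∈ Wcs.liftLeaf p y → r' ∈ Wu.liftLeaf p x →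
      r' ∈ Wcs.liftLeaf p y → r = r' :=
    fun x y r r' h1 h2 h3 h4 => (hgps.u_cs x y).unique ⟨h1, h2⟩ ⟨h3, h4⟩
  have huniq_s : ∀ x y r r', r ∈ Ws.liftLeaf p x → r ∈ Wcu.liftLeaf p y → r' ∈ Ws.liftLeaf p x →
      r' ∈ Wcu.liftLeaf p y → r = r' :=
    fun x y r r' h1 h2 h3 h4 => (hgps.s_cu x y).unique ⟨h1, h2⟩ ⟨h3, h4⟩
  choose Iu hIu using fun z : M' × M' => (hgps.u_cs z.1 z.2).exists
  choose Is hIs using fun z : M' × M' => (hgps.s_cu z.1 z.2).exists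
  have hIu_cont : Continuous Iu := Foliation.continuous_of_mem_liftLeaf_inter hl (fun x N hN => by
    obtain ⟨ψ, hψ, hx⟩ := Wcs.exists_chart (p x)
    filter_upwards [hloc_us x ψ hψ hx N hN] with y ⟨r, h1, h2, h3, _⟩ using ⟨r, h1, h2, h3⟩)
    hIu huniq_u
  have hIs_cont : Continuous Is := Foliation.continuous_of_mem_liftLeaf_inter hl (fun x N hN => by
    obtain ⟨ψ, hψ, hx⟩ := Wcu.exists_chart (p x)
    filter_upwards [hloc_su x ψ hψ hx N hN] with y ⟨r, h1, h2, h3, _⟩ using ⟨r, h1, h2, h3⟩)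
    hIs huniq_s
  -- A point y of W^c(x) near x is, by uniqueness, the local intersection of W^u(y) with the
  -- center-stable plaque of x, and likewise of W^s(y) with the center-unstable plaque. It therefore
  -- lies in both plaques, which meet in the center plaque.
  have hemb : ∀ x : M', ∀ φ ∈ Wc.charts, p x ∈ φ.source →
      ∀ᶠ y in 𝓝 x, y ∈ Wc.liftLeaf p x → (φ (p y)).2 = (φ (p x)).2 := by
    intro x φ hφ hx
    obtain ⟨ψ, hψ, hxψ⟩ := Wcs.exists_chart (p x)
    obtain ⟨χ, hχ, hxχ⟩ := Wcu.exists_chart (p x)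
    obtain ⟨k, e, he⟩ := hf.continuous_c.exists_isFrameAt (p x)
    have h0 := hWc.eventually_snd_eq_of_snd_eq (F := fun x => Es x ⊔ Eu x) hWcs hWcu hc_cs hc_cu he
      (hf.isCompl_c_su _) (hf.su_inf_cs_inf_cu _) hφ hx hψ hxψ hχ hxχ
    have ht : Tendsto (fun y : M' => (y, x)) (𝓝 x) (𝓝 (x, x)) :=
      (Continuous.tendsto (by fun_prop) x : Tendsto (fun y : M' => (y, x)) (𝓝 x) (𝓝 (x, x)))
    filter_upwards [hl.continuous.continuousAt.eventually h0,
      ht.eventually (hloc_us x ψ hψ hxψ univ univ_mem),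
      ht.eventually (hloc_su x χ hχ hxχ univ univ_mem)]
      with y h1 ⟨r, _, hr1, hr2, hr3⟩ ⟨r', _, hr1', hr2', hr3'⟩ hy
    have e1 : r = y := huniq_u y x _ _ hr1 hr2 (Foliation.mem_liftLeaf_self _) (hsub_cs _ hy)
    have e2 : r' = y := huniq_s y x _ _ hr1' hr2' (Foliation.mem_liftLeaf_self _) (hsub_cu _ hy)
    rw [e1] at hr3
    rw [e2] at hr3'
    exact h1 hr3 hr3'
  have hdeck : ∀ y y' : M', p y = p y' → ∃ g : M' → M', Continuous g ∧ p ∘ g = p ∧ g y = y' :=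
    fun y y' h => hp.exists_deck h
  have hfix : ∀ g : M' → M', Continuous g → p ∘ g = p → ∀ y, g y ∈ Wc.liftLeaf p y →
      ∀ z, g z ∈ Wc.liftLeaf p z := by
    intro g hg hpg y hy z
    -- Membership of g z in W^cs(z) and in W^cu(z) amounts to equations between continuous maps into
    -- a Hausdorff space.
    have hclosed : IsClosed {z | g z ∈ Wc.liftLeaf p z} := by
      have : {z | g z ∈ Wc.liftLeaf p z} = {z | Iu (g z, z) = g z} ∩ {z | Is (g z, z) = g z} := by
        ext z
        constructor
        · intro hz
          exact ⟨huniq_u _ _ _ _ (hIu (g z, z)).1 (hIu (g z, z)).2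
              (Foliation.mem_liftLeaf_self _) (hsub_cs _ hz),
            huniq_s _ _ _ _ (hIs (g z, z)).1 (hIs (g z, z)).2
              (Foliation.mem_liftLeaf_self _) (hsub_cu _ hz)⟩
        · rintro ⟨h1, h2⟩
          have h3 := (hIu (g z, z)).2
          have h4 := (hIs (g z, z)).2
          rw [show Iu (g z, z) = g z from h1] at h3
          rw [show Is (g z, z) = g z from h2] at h4
          exact hc _ _ h3 h4
      rw [this]
      exact (isClosed_eq (by fun_prop) hg).inter (isClosed_eq (by fun_prop) hg)
    have hopen : IsOpen {z | g z ∈ Wc.liftLeaf p z} :=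
      isOpen_iff_mem_nhds.2 fun z hz => hholo.eventually_map_mem_liftLeaf hl hg hpg hz
    exact (IsClopen.eq_univ ⟨hclosed, hopen⟩ ⟨y, hy⟩).ge (mem_univ z)
  intro x y
  obtain ⟨x, rfl⟩ := hsurj x
  obtain ⟨y, rfl⟩ := hsurj y
  -- A stable slide takes x to z, in the center-unstable leaf of y. The center leaf of z meets
  -- W^u(y) at w, from which an unstable slide leads to y.
  let z := Is (x, y)
  obtain ⟨w, ⟨hw1, hw2⟩, -⟩ := hgps.c_u z y (hIs (x, y)).2
  obtain ⟨h1⟩ := Foliation.nonempty_leaf_homeomorph_of_product hp hemb hsub_cs hsub_cu hs_cs hc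
    hIs_cont hIs huniq_s hdeck hfix (Foliation.liftLeaf_symm (hIs (x, y)).1)
  obtain ⟨h2⟩ := Foliation.nonempty_leaf_homeomorph_of_product hp hemb hsub_cu hsub_cs hu_cu
    (fun a b h h' => hc a b h' h) hIu_cont hIu huniq_u hdeck hfix hw2
  -- z and w lie on one lifted center leaf, so the identity descends to the change of base point.
  obtain ⟨h3⟩ := Foliation.nonempty_leaf_homeomorph hp hemb (x := z) (z := w) continuous_id
    continuous_id (fun _ h => Foliation.liftLeaf_trans (Foliation.liftLeaf_symm hw1) h)
    (fun _ h => Foliation.liftLeaf_trans hw1 h) (fun _ _ _ _ h => h) (fun _ _ _ _ h => h)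
    (fun _ _ => rfl) (fun _ _ => rfl)
  exact ⟨h1.trans (h3.trans h2)⟩
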